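/- Let $\mathbb{H}=\{\operatorname{Re} z>0\}$, $H_1=\{\operatorname{Re} z>1\}$, and let $\nu_0>0$. **Tract data.** Let $(r_j),(R_j),(\varepsilon_j),(\tau_j)$, $j\ge 0$, be sequences of positive reals with $r_0>6$, $R_j>r_j+\max\{5+3\nu_0,30\}$, $r_{j+1}>R_j+\max\{2\nu_0,60\}$, $0<\varepsilon_j\le 1$, $\tau_j=R_j-2-3\nu_0$ and $r_j<\tau_j<R_j-1-3\pi$ for all $j\ge 0$. Let $T$ be the half-strip $\{\operatorname{Re} z>4,\ |\operatorname{Im} z|<\pi\}$ with the following closed segments removed for every $j\ge 0$: $r_j+i[-\pi,\tfrac{\pi}{3}]$, $[r_j,R_j-1]+\tfrac{\pi i}{3}$, $[r_j+1,R_j]-\tfrac{\pi i}{3}$, $R_j+i[-\tfrac{\pi}{3},\pi]$, $\tau_j+i[\tfrac{\pi}{3},\tfrac{\pi(2-\varepsilon_j)}{3}]$ and $\tau_j+i[\tfrac{\pi(2+\varepsilon_j)}{3},\pi]$. Let $F\colon T\to\mathbb{H}$ be the conformal isomorphism with $F(5)=5$ and $F(z)\to\infty$ as $z\to\infty$ in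 $T$. For $\rho>0$ put $\Gamma_\rho=\{z\in T\colon |F(z)|=\rho\}$, and let $W_j^+$ and $W_j^-$ be the sets of $z\in T$ with $r_j\le\operatorname{Re} z\le R_j$ and $-\tfrac{\pi}{3}<\operatorname{Im} z<\tfrac{\pi}{3}$, respectively $-\pi<\operatorname{Im} z<-\tfrac{\pi}{3}$. The datum is a *counterexample tract datum* if there are positive $(\rho_j)_{j\ge1}$, $(\dot\rho_j)_{j\ge1}$ such that (a) $r_j+R_{j-1}+1+2\pi\le\rho_j<\dot\rho_j/2<\dot\rho_j<R_j-2-4\nu_0$ for all $j\ge1$; (b) for all $j\ge0$, $\Gamma_{\rho_{j+1}}\subset W_j^+$ and $\Gamma_{\dot\rho_{j+1}}\subset W_j^-$, and both sets have real parts strictly between $R_j-2-3\nu_0$ and $R_j-2-\nu_0$. **The class $\mathcal{B}_{\log}^p$.** A map $G\colon\mathcal{U}\to H$ belongs to $\mathcal{B}_{\log}^p$ if: $H$ is a $2\pi i$-periodic Jordan domain containing a right half-plane; every component of $\mathcal{U}$ is an unbounded Jordan domain (boundaries of Jordan domains being taken in the Riemann sphere) with real parts bounded below and unbounded above; the components have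 disjoint closures and accumulate only at $\infty$; $G$ maps every component conformally onto $H$ and extends continuously to $\overline{\mathcal{U}}$ (closure in $\mathbb{C}$); $\exp$ is injective on every component; and $\mathcal{U}$ and $G$ are $2\pi i$-periodic. It is of *disjoint type* if $\overline{\mathcal{U}}\subset H$; then $J(G)$ is the set of $z\in\overline{\mathcal{U}}$ such that $G^n(z)$ is defined and in $\overline{\mathcal{U}}$ for all $n\ge0$. **Theorem.** Let $F$ be the conformal map of a counterexample tract datum, let $\tilde T=F^{-1}(H_1)$ and $\tilde{\mathcal{U}}=\tilde T+2\pi i\mathbb{Z}$, and let $\tilde F\colon\tilde{\mathcal{U}}\to H_1$ be given by $\tilde F(z)=F(z-2\pi i m)$ for $z\in\tilde T+2\pi i m$, $m\in\mathbb{Z}$. Then $\tilde F\in\mathcal{B}_{\log}^p$ is of disjoint type, and $J(\tilde F)$ contains no curve to $\infty$; that is, there is no continuous $\gamma\colon[0,\infty)\to J(\tilde F)$ with $|\gamma(t)|\to\infty$ as $t\to\infty$. -/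

import Mathlib

open scoped Real Topology

/-! Logarithmic maps -/

/-- A (possibly unbounded) Jordan domain in `ℂ`: a nonempty connected open set whose boundary,
taken in the Riemann sphere `OnePoint ℂ`, is a Jordan curve. -/
def IsJordanDomain (V : Set ℂ) : Prop :=
  IsOpen V ∧ IsConnected V ∧
    ∃ γ : Circle → OnePoint ℂ, Continuous γ ∧ Function.Injective γ ∧
      Set.range γ = frontier ((fun z : ℂ => (z : OnePoint ℂ)) '' V)

/-- `F` maps the open set `V` conformally onto `W`. -/
def IsConformalIso (F : ℂ → ℂ) (V W : Set ℂ) : Prop :=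
  DifferentiableOn ℂ F V ∧ Set.BijOn F V W

/-- The class `B_log`: the map `F : U → H` satisfies the conditions (a)-(f). The tracts, i.e. the
connected components of `U`, are the sets `connectedComponentIn U z` with `z ∈ U`. The values of
`F` off `U` are irrelevant. -/
structure IsBlog (U H : Set ℂ) (F : ℂ → ℂ) : Prop where
  range_jordan : IsJordanDomain H
  range_periodic : ∀ z : ℂ, z + 2 * π * Complex.I ∈ H ↔ z ∈ H
  range_halfPlane : ∃ x : ℝ, {z : ℂ | x < z.re} ⊆ H
  tract_jordan : ∀ z ∈ U, IsJordanDomain (connectedComponentIn U z)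
  tract_unbounded : ∀ z ∈ U, ¬ Bornology.IsBounded (connectedComponentIn U z)
  tract_bddBelow : ∀ z ∈ U, BddBelow (Complex.re '' connectedComponentIn U z)
  tract_not_bddAbove : ∀ z ∈ U, ¬ BddAbove (Complex.re '' connectedComponentIn U z)
  disjoint_closures : ∀ z ∈ U, ∀ w ∈ U, connectedComponentIn U z ≠ connectedComponentIn U w →
    Disjoint (closure (connectedComponentIn U z)) (closure (connectedComponentIn U w))
  accumulate_infty : ∀ z : ℕ → ℂ, (∀ n, z n ∈ U) →
    (∀ n k, n ≠ k → connectedComponentIn U (z n) ≠ connectedComponentIn U (z k)) →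
    Filter.Tendsto z Filter.atTop (Bornology.cobounded ℂ)
  conformal : ∀ z ∈ U, IsConformalIso F (connectedComponentIn U z) H
  extends_closure : ∃ G : ℂ → ℂ, ContinuousOn G (closure U) ∧ Set.EqOn G F U
  exp_injOn : ∀ z ∈ U, Set.InjOn Complex.exp (connectedComponentIn U z)
  domain_periodic : ∀ z : ℂ, z + 2 * π * Complex.I ∈ U ↔ z ∈ U

/-- The class `B_log^p`: in addition `F` is `2πi`-periodic. -/
structure IsBlogPeriodic (U H : Set ℂ) (F : ℂ → ℂ) : Prop extends IsBlog U H F where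
  periodic : ∀ z ∈ U, F (z + 2 * π * Complex.I) = F z

/-- `F : U → H` is of disjoint type. -/
def IsDisjointType (U H : Set ℂ) : Prop := closure U ⊆ H

/-- The Julia set of `F : U → H`: the points of `closure U` all of whose iterates, under the
continuous extension of `F` to `closure U`, are defined and lie in `closure U`. -/
noncomputable def logJuliaSet (U : Set ℂ) (F : ℂ → ℂ) : Set ℂ :=
  {z | ∀ n : ℕ, (extendFrom U F)^[n] z ∈ closure U}

/-- The set `J` contains a curve to infinity. -/
def ContainsCurveToInfinity (J : Set ℂ) : Prop :=
  ∃ γ : ℝ → ℂ, ContinuousOn γ (Set.Ici 0) ∧ (∀ t, 0 ≤ t → γ t ∈ J) ∧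
    Filter.Tendsto γ Filter.atTop (Bornology.cobounded ℂ)

/-! Normalised conformal maps onto the right half-plane and their periodic extensions -/

/-- `F : T → {Re > 0}` is a conformal isomorphism with `F 5 = 5`, and `F z → ∞` as `z → ∞`
in `T`. -/
structure IsNormalisedMap (T : Set ℂ) (F : ℂ → ℂ) : Prop where
  conformal : IsConformalIso F T {z : ℂ | 0 < z.re}
  map_five : F 5 = 5
  tendsto_infty : Filter.Tendsto F (Bornology.cobounded ℂ ⊓ Filter.principal T)
    (Bornology.cobounded ℂ)

/-- The half-plane `H_1`. -/
def halfPlaneOne : Set ℂ := {z : ℂ | 1 < z.re}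

/-- The tract `F⁻¹(H_1)` of the restricted map. -/
def restrictedTract (T : Set ℂ) (F : ℂ → ℂ) : Set ℂ := {z : ℂ | z ∈ T ∧ F z ∈ halfPlaneOne}

/-- The union of all `2πiℤ`-translates of `F⁻¹(H_1)`. -/
def periodicDomain (T : Set ℂ) (F : ℂ → ℂ) : Set ℂ :=
  {z : ℂ | ∃ m : ℤ, z - 2 * π * Complex.I * m ∈ restrictedTract T F}

/-- The `2πi`-periodic extension of a map `F` defined on a subset of `{|Im z| < π}`: the value at
`z` is `F (z - 2πim)`, where `m` is the integer such that `z - 2πim` lies in this strip. -/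
noncomputable def periodicExtension (F : ℂ → ℂ) (z : ℂ) : ℂ :=
  F (z - 2 * π * Complex.I * (round (z.im / (2 * π)) : ℤ))

theorem periodicExtension_apply (F : ℂ → ℂ) (z : ℂ) (m : ℤ)
    (h : |(z - 2 * π * Complex.I * m).im| < π) :
    periodicExtension F z = F (z - 2 * π * Complex.I * m) := by
  have hpi := Real.pi_pos
  have him : (z - 2 * π * Complex.I * m).im = z.im - 2 * π * m := by simp
  rw [him, abs_lt] at h
  have hr : round (z.im / (2 * π)) = m := by
    rw [round_eq, Int.floor_eq_iff]
    have e : z.im = 2 * π * (z.im / (2 * π)) := by field_simp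
    constructor <;> nlinarith [h.1, h.2]
  rw [periodicExtension, hr]

/-! Tract data -/

/-- A tract datum (an element of `Ξ_0`). All four sequences are then positive. -/
structure TractDatum where
  r : ℕ → ℝ
  R : ℕ → ℝ
  ε : ℕ → ℝ
  τ : ℕ → ℝ
  r_zero : 6 < r 0
  r_R : ∀ j, r j + 30 < R j
  R_r : ∀ j, R j + 60 < r (j + 1)
  ε_pos : ∀ j, 0 < ε j
  ε_le : ∀ j, ε j ≤ 1
  r_τ : ∀ j, r j < τ j
  τ_R : ∀ j, τ j < R j - 1 - 3 * π

namespace TractDatum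

/-- The union `L^ξ` of the slits. -/
def slits (ξ : TractDatum) : Set ℂ :=
  ⋃ j : ℕ,
    ({z : ℂ | z.re = ξ.r j ∧ z.im ∈ Set.Icc (-π) (π / 3)} ∪
     {z : ℂ | z.re ∈ Set.Icc (ξ.r j) (ξ.R j - 1) ∧ z.im = π / 3} ∪
     {z : ℂ | z.re ∈ Set.Icc (ξ.r j + 1) (ξ.R j) ∧ z.im = -(π / 3)} ∪
     {z : ℂ | z.re = ξ.R j ∧ z.im ∈ Set.Icc (-(π / 3)) π} ∪
     {z : ℂ | z.re = ξ.τ j ∧ z.im ∈ Set.Icc (π / 3) (π * (2 - ξ.ε j) / 3)} ∪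
     {z : ℂ | z.re = ξ.τ j ∧ z.im ∈ Set.Icc (π * (2 + ξ.ε j) / 3) π})

/-- The tract `T^ξ`. -/
def tract (ξ : TractDatum) : Set ℂ := {z : ℂ | 4 < z.re ∧ |z.im| < π} \ ξ.slits

/-- The vertical geodesic `Γ_ρ` of `T^ξ`, with respect to the normalised map `F`. -/
def verticalGeodesic (ξ : TractDatum) (F : ℂ → ℂ) (ρ : ℝ) : Set ℂ :=
  {z : ℂ | z ∈ ξ.tract ∧ ‖F z‖ = ρ}

/-- The bottom two thirds `W_j` of the `j`-th wiggle. -/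
def wiggle (ξ : TractDatum) (j : ℕ) : Set ℂ :=
  {z : ℂ | z ∈ ξ.tract ∧ ξ.r j ≤ z.re ∧ z.re ≤ ξ.R j ∧ -π ≤ z.im ∧ z.im ≤ π / 3}

/-- The middle third `W_j^+` of the `j`-th wiggle. -/
def wigglePlus (ξ : TractDatum) (j : ℕ) : Set ℂ :=
  {z : ℂ | z ∈ ξ.wiggle j ∧ -(π / 3) < z.im ∧ z.im < π / 3}

/-- The lower third `W_j^-` of the `j`-th wiggle. -/
def wiggleMinus (ξ : TractDatum) (j : ℕ) : Set ℂ :=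
  {z : ℂ | z ∈ ξ.wiggle j ∧ -π < z.im ∧ z.im < -(π / 3)}

/-- The class `Ξ` of tract data, with spacing and gate positions determined by `ν₀`. -/
structure InXi (ξ : TractDatum) (ν₀ : ℝ) : Prop where
  r_R : ∀ j, ξ.r j + max (5 + 3 * ν₀) 30 < ξ.R j
  R_r : ∀ j, ξ.R j + max (2 * ν₀) 60 < ξ.r (j + 1)
  τ_eq : ∀ j, ξ.τ j = ξ.R j - 2 - 3 * ν₀

/-- `ξ ∈ Ξ` is a counterexample tract datum, where `F` is the normalised conformal map of `T^ξ`;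
`ρ` and `ρ'` are the two sequences of radii, indexed from `1` (the values at `0` are not used). -/
def IsCounterexample (ξ : TractDatum) (ν₀ : ℝ) (F : ℂ → ℂ) : Prop :=
  ξ.InXi ν₀ ∧ ∃ ρ ρ' : ℕ → ℝ,
    (∀ j, 1 ≤ j → 0 < ρ j ∧ 0 < ρ' j) ∧
    (∀ j, 1 ≤ j → ξ.r j + ξ.R (j - 1) + 1 + 2 * π ≤ ρ j ∧ ρ j < ρ' j / 2 ∧ ρ' j / 2 < ρ' j ∧
      ρ' j < ξ.R j - 2 - 4 * ν₀) ∧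
    (∀ j, ξ.verticalGeodesic F (ρ (j + 1)) ⊆ ξ.wigglePlus j ∧
      ξ.verticalGeodesic F (ρ' (j + 1)) ⊆ ξ.wiggleMinus j ∧
      ∀ z ∈ ξ.verticalGeodesic F (ρ (j + 1)) ∪ ξ.verticalGeodesic F (ρ' (j + 1)),
        ξ.R j - 2 - 3 * ν₀ < z.re ∧ z.re < ξ.R j - 2 - ν₀)

end TractDatum

/-!
Write `T` for the tract, `g` for the inverse of `F : T → {Re z > 0}`, and call `Γ_s` the vertical
geodesic `|F z| = s`. An iterate of a curve `γ` is written `γ_n`.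

*Separation.* In the lower channel of the `j`-th wiggle take the crosscut `Re z = τ_j`. It is
connected and misses the geodesic `Γ_s`, `s = ρ'_{j+1}`, which lies behind it. Hence one of the two
sides `|F z| < s` and `|F z| > s` of the geodesic, each connected as the `g`-image of a connected
set, misses the crosscut. As `Γ_s` is in the boundary of both sides, a side that misses the crosscut
cannot meet the part of `T` in front of it; since `F 5 = 5`, it follows that `|F z| < s` in front of
the crosscut (`TractDatum.norm_lt_of_mem_beforeCrosscut`). In particular `F` is bounded on the part
of `T` to the left of any vertical line (`BoundedToLeft`).

*Membership in the class.* By this boundedness, `F⁻¹({Re z ≥ 1})` is closed in the plane and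
contained in `T`, and `g(1 + it)` tends to infinity with `t`. Closures of tracts are therefore
contained in translates of `T`, where `F` is continuous, and the boundary of a tract is a properly
embedded line, which `∞` completes to a Jordan curve (`isBlogPeriodic_periodicExtension`). No
boundary behaviour of conformal maps is needed.

*No curve to infinity.* Let `γ` be such a curve in the Julia set. All its iterates `γ_n` are
curves to infinity, each in one translate of `T` (`iterate_curve`), and, for a `j` that depends on
`γ(0)`, the separation property gives `|γ_n(0)| < ρ'_{j+n+1}` by induction; this also bounds
`|Im γ_n|`. Suppose that `|γ_{n+1}|` passes between the radii `ρ_{k+1}` and `ρ'_{k+1}`, where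
`k = j + n + 2`. Then, up to translation, `γ_n` passes between a geodesic in the middle channel of the
`k`-th wiggle and one in its lower channel, both to the right of `τ_k`. In between, it has to
visit the left end `Re z < r_k + 1` of the wiggle (`TractDatum.exists_traverse_of_crosses`). So
`|γ_n|` passes from at least `ρ'_k` to at most `ρ_k` and back: a crossing for `γ_{n+1}` yields two
crossings for `γ_n` (`HasCrossings.double`). Every `γ_n` has at least one crossing, so `γ` crosses
a fixed annulus at least `2 ^ n` times for all `n`, which contradicts uniform continuity
(`HasCrossings.exists_le`).
-/

/-! ### Jordan domains bounded by an unbounded arc -/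

/-- The circle is the one-point compactification of the line. -/
theorem nonempty_circle_homeomorph_onePoint : Nonempty (Circle ≃ₜ OnePoint ℝ) := by
  have hv : ‖(1 : ℂ)‖ = 1 := norm_one
  have : Fact (Module.finrank ℝ ℂ = 1 + 1) := ⟨by simp⟩
  have hdim : Module.finrank ℝ ℝ = Module.finrank ℝ (Submodule.span ℝ {(1 : ℂ)})ᗮ := by
    rw [Submodule.finrank_orthogonal_span_singleton (n := 1) one_ne_zero, Module.finrank_self]
  let e : ℝ ≃ₜ (Submodule.span ℝ {(1 : ℂ)})ᗮ :=
    (FiniteDimensional.nonempty_continuousLinearEquiv_of_finrank_eq hdim).some.toHomeomorph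
  let f : Circle ≃ₜ Metric.sphere (0 : ℂ) 1 :=
    { toFun := fun z => ⟨z, by simp [Circle.norm_coe]⟩
      invFun := fun z => ⟨z, z.2⟩
      left_inv := fun z => rfl
      right_inv := fun z => rfl
      continuous_toFun := by fun_prop
      continuous_invFun := continuous_induced_rng.2 continuous_subtype_val }
  exact ⟨f.trans ((e.onePointCongr.trans (onePointHyperplaneHomeoUnitSphere hv)).symm)⟩

/-- An unbounded open set acquires only the point `∞` as a further frontier point in the sphere. -/
theorem frontier_image_coe_onePoint {V : Set ℂ} (hV : IsOpen V) (hb : ¬ Bornology.IsBounded V) :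
    frontier ((fun z : ℂ => (z : OnePoint ℂ)) '' V) =
      insert OnePoint.infty ((fun z : ℂ => (z : OnePoint ℂ)) '' frontier V) := by
  have hopen : IsOpen ((fun z : ℂ => (z : OnePoint ℂ)) '' V) := OnePoint.isOpen_image_coe.2 hV
  rw [hopen.frontier_eq, hV.frontier_eq]
  ext p
  induction p using OnePoint.rec with
  | infty =>
    simp only [Set.mem_sdiff, Set.mem_insert_iff, true_or, iff_true]
    refine ⟨?_, by simp⟩
    rw [mem_closure_iff_frequently]
    intro h
    have h2 : ∀ᶠ z : ℂ in Filter.coclosedCompact ℂ,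
        (z : OnePoint ℂ) ∉ (fun z : ℂ => (z : OnePoint ℂ)) '' V :=
      OnePoint.tendsto_coe_infty.eventually h
    rw [Filter.coclosedCompact_eq_cocompact, ← Metric.cobounded_eq_cocompact] at h2
    apply hb
    rw [Bornology.isBounded_def]
    filter_upwards [h2] with z hz hzV
    exact hz ⟨z, hzV, rfl⟩
  | coe z =>
    have hc : (z : OnePoint ℂ) ∈ closure ((fun z : ℂ => (z : OnePoint ℂ)) '' V) ↔
        z ∈ closure V := by
      rw [OnePoint.isOpenEmbedding_coe.isInducing.closure_eq_preimage_closure_image V]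
      rfl
    simp only [Set.mem_sdiff, hc, Set.mem_insert_iff, OnePoint.coe_ne_infty, false_or,
      Set.mem_image, OnePoint.coe_eq_coe, exists_eq_right]

/-- A domain whose frontier in `ℂ` is a properly embedded line is a Jordan domain: the point `∞`
closes the line up to a Jordan curve. -/
theorem isJordanDomain_of_proper_arc {V : Set ℂ} {c : ℝ → ℂ} (hV : IsOpen V) (hconn : IsConnected V)
    (hc : Continuous c) (hinj : Function.Injective c)
    (hlim : Filter.Tendsto c (Filter.cocompact ℝ) (Filter.cocompact ℂ))
    (hrange : Set.range c = frontier V) : IsJordanDomain V := by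
  refine ⟨hV, hconn, ?_⟩
  have hb : ¬ Bornology.IsBounded V := by
    intro hb
    have h1 : Bornology.IsBounded (Set.range c) :=
      hrange ▸ hb.closure.subset frontier_subset_closure
    rw [← Metric.cobounded_eq_cocompact (α := ℂ)] at hlim
    have h2 : ∀ᶠ t in Filter.cocompact ℝ, c t ∉ Set.range c := hlim.eventually h1
    obtain ⟨t, ht⟩ := h2.exists
    exact ht ⟨t, rfl⟩
  obtain ⟨e⟩ := nonempty_circle_homeomorph_onePoint
  refine ⟨fun z => OnePoint.map c (e z),
    (OnePoint.continuous_map hc (by simpa only [Filter.coclosedCompact_eq_cocompact])).comp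
      e.continuous,
    (Option.map_injective hinj).comp e.injective, ?_⟩
  rw [frontier_image_coe_onePoint hV hb, ← hrange]
  ext p
  constructor
  · rintro ⟨z, rfl⟩
    dsimp only
    induction e z using OnePoint.rec with
    | infty => exact Or.inl rfl
    | coe t => exact Or.inr ⟨c t, ⟨t, rfl⟩, rfl⟩
  · rintro (rfl | ⟨_, ⟨t, rfl⟩, rfl⟩)
    · exact ⟨e.symm OnePoint.infty, by simp⟩
    · exact ⟨e.symm t, by simp⟩

theorem tendsto_cocompact_one_add_mul_I :
    Filter.Tendsto (fun t : ℝ => 1 + t * Complex.I) (Filter.cocompact ℝ) (Filter.cocompact ℂ) := by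
  rw [← Metric.cobounded_eq_cocompact, ← Metric.cobounded_eq_cocompact,
    ← tendsto_norm_atTop_iff_cobounded]
  refine Filter.tendsto_atTop_mono (fun t => ?_) tendsto_norm_cobounded_atTop
  simpa using Complex.abs_im_le_norm (1 + t * Complex.I)

theorem one_add_mul_I_injective : Function.Injective fun t : ℝ => 1 + t * Complex.I := by
  intro s t h
  simpa using congrArg Complex.im h

theorem isJordanDomain_halfPlaneOne : IsJordanDomain halfPlaneOne := by
  refine isJordanDomain_of_proper_arc (isOpen_lt continuous_const Complex.continuous_re)
    ⟨⟨2, by simp [halfPlaneOne]⟩, (convex_halfSpace_re_gt 1).isPreconnected⟩ (by fun_prop)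
    one_add_mul_I_injective tendsto_cocompact_one_add_mul_I ?_
  rw [halfPlaneOne, Complex.frontier_setOfPred_lt_re]
  ext z
  constructor
  · rintro ⟨t, rfl⟩
    simp
  · intro (hz : z.re = 1)
    exact ⟨z.im, by apply Complex.ext <;> simp [hz]⟩

/-! ### Inverses of conformal maps -/

/-- An injective holomorphic map is open. -/
theorem IsConformalIso.nhds_le_map {F : ℂ → ℂ} {V W : Set ℂ} (hF : IsConformalIso F V W)
    (hV : IsOpen V) {z : ℂ} (hz : z ∈ V) : 𝓝 (F z) ≤ Filter.map F (𝓝 z) := by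
  have han : AnalyticAt ℂ F z := hF.1.analyticAt (hV.mem_nhds hz)
  refine han.eventually_constant_or_nhds_le_map_nhds.resolve_left fun h => ?_
  have h1 : ∀ᶠ w in 𝓝[≠] z, w = z := by
    filter_upwards [h.filter_mono nhdsWithin_le_nhds,
      mem_nhdsWithin_of_mem_nhds (hV.mem_nhds hz)] with w hw hwV
    exact hF.2.injOn hwV hz hw
  obtain ⟨w, hw, hw'⟩ := (h1.and self_mem_nhdsWithin).exists
  exact hw' hw

theorem IsConformalIso.exists_inverse {F : ℂ → ℂ} {V W : Set ℂ} (hF : IsConformalIso F V W)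
    (hV : IsOpen V) :
    ∃ g : ℂ → ℂ, ContinuousOn g W ∧ Set.MapsTo g W V ∧ Set.InvOn g F V W := by
  refine ⟨Function.invFunOn F V, ?_, hF.2.surjOn.mapsTo_invFunOn, hF.2.invOn_invFunOn⟩
  intro w hw
  obtain ⟨z, hz, rfl⟩ := hF.2.surjOn hw
  have hg : Function.invFunOn F V (F z) = z := hF.2.invOn_invFunOn.1 hz
  refine ContinuousAt.continuousWithinAt ?_
  rw [ContinuousAt, hg]
  refine Filter.Tendsto.mono_left ?_ (hF.nhds_le_map hV hz)
  rw [Filter.tendsto_map'_iff]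
  refine (Filter.tendsto_id (x := 𝓝 z)).congr' ?_
  filter_upwards [hV.mem_nhds hz] with w hw
  exact (hF.2.invOn_invFunOn.1 hw).symm

/-! ### Preimages of the half-plane `Re z > 1` -/

/-- `F` is bounded on every part of `T` that lies to the left of a vertical line. -/
def BoundedToLeft (T : Set ℂ) (F : ℂ → ℂ) : Prop :=
  ∀ x : ℝ, ∃ C : ℝ, ∀ z ∈ T, z.re < x → ‖F z‖ < C

/-- The relative closure in `T` of the restricted tract. -/
def closedTract (T : Set ℂ) (F : ℂ → ℂ) : Set ℂ := {z : ℂ | z ∈ T ∧ 1 ≤ (F z).re}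

theorem restrictedTract_subset_closedTract (T : Set ℂ) (F : ℂ → ℂ) :
    restrictedTract T F ⊆ closedTract T F := fun _ hz => ⟨hz.1, le_of_lt hz.2⟩

/-- The relative closure is closed in the plane: a bounded part of it is mapped into a compact
subset of the half-plane `Re z > 0`, and so stays away from the boundary of `T`. -/
theorem isClosed_closedTract {T : Set ℂ} {F : ℂ → ℂ} (hT : IsOpen T)
    (hF : IsConformalIso F T {z : ℂ | 0 < z.re}) (hb : BoundedToLeft T F) :
    IsClosed (closedTract T F) := by
  obtain ⟨g, hgc, hgm, hg⟩ := hF.exists_inverse hT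
  rw [← closure_subset_iff_isClosed]
  intro z hz
  obtain ⟨C, hC⟩ := hb (z.re + 1)
  let Q : Set ℂ := Metric.closedBall 0 C ∩ {w : ℂ | 1 ≤ w.re}
  have hQ : IsCompact Q := (isCompact_closedBall 0 C).inter_right
    (isClosed_le continuous_const Complex.continuous_re)
  have hQs : Q ⊆ {w : ℂ | 0 < w.re} := fun w hw => one_pos.trans_le (show 1 ≤ w.re from hw.2)
  have hgQ : IsClosed (g '' Q) := (hQ.image_of_continuousOn (hgc.mono hQs)).isClosed
  have hsub : {w : ℂ | w.re < z.re + 1} ∩ closedTract T F ⊆ g '' Q := by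
    rintro w ⟨hw, hwT, hw1⟩
    refine ⟨F w, ⟨?_, hw1⟩, hg.1 hwT⟩
    simpa using (hC w hwT hw).le
  have hzQ : z ∈ g '' Q := by
    have h1 : IsOpen {w : ℂ | w.re < z.re + 1} := isOpen_lt Complex.continuous_re continuous_const
    have h2 := h1.inter_closure (t := closedTract T F) ⟨by simp, hz⟩
    exact hgQ.closure_subset_iff.2 hsub h2
  obtain ⟨w, hw, rfl⟩ := hzQ
  refine ⟨hgm (hQs hw), ?_⟩
  rw [hg.2 (hQs hw)]
  exact hw.2

theorem isOpen_restrictedTract {T : Set ℂ} {F : ℂ → ℂ} (hT : IsOpen T)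
    (hF : ContinuousOn F T) : IsOpen (restrictedTract T F) :=
  hF.isOpen_inter_preimage hT (isOpen_lt continuous_const Complex.continuous_re)

theorem closure_restrictedTract {T : Set ℂ} {F : ℂ → ℂ} (hT : IsOpen T)
    (hF : IsConformalIso F T {z : ℂ | 0 < z.re}) (hb : BoundedToLeft T F) :
    closure (restrictedTract T F) = closedTract T F := by
  refine ((isClosed_closedTract hT hF hb).closure_subset_iff.2
    (restrictedTract_subset_closedTract T F)).antisymm ?_
  obtain ⟨g, hgc, hgm, hg⟩ := hF.exists_inverse hT
  rintro z ⟨hzT, hz⟩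
  have h1 : F z ∈ closure halfPlaneOne := by
    rw [halfPlaneOne, Complex.closure_setOfPred_lt_re]
    exact hz
  have hsub : halfPlaneOne ⊆ {w : ℂ | 0 < w.re} := fun w (hw : 1 < w.re) => one_pos.trans hw
  have h2 : ContinuousWithinAt g halfPlaneOne (F z) :=
    (hgc (F z) (hF.2.mapsTo hzT)).mono hsub
  have h3 := h2.mem_closure_image h1
  rw [hg.1 hzT] at h3
  refine closure_mono ?_ h3
  rintro _ ⟨w, hw, rfl⟩
  refine ⟨hgm (hsub hw), ?_⟩
  rw [hg.2 (hsub hw)]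
  exact hw

theorem isConformalIso_restrictedTract {T : Set ℂ} {F : ℂ → ℂ}
    (hF : IsConformalIso F T {z : ℂ | 0 < z.re}) :
    IsConformalIso F (restrictedTract T F) halfPlaneOne := by
  refine ⟨hF.1.mono fun z hz => hz.1, fun z hz => hz.2, hF.2.injOn.mono fun z hz => hz.1, ?_⟩
  intro w (hw : 1 < w.re)
  obtain ⟨z, hz, rfl⟩ := hF.2.surjOn (one_pos.trans hw : 0 < w.re)
  exact ⟨z, ⟨hz, hw⟩, rfl⟩

theorem isConnected_restrictedTract {T : Set ℂ} {F : ℂ → ℂ} (hT : IsOpen T)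
    (hF : IsConformalIso F T {z : ℂ | 0 < z.re}) : IsConnected (restrictedTract T F) := by
  obtain ⟨g, hgc, hgm, hg⟩ := (isConformalIso_restrictedTract hF).exists_inverse
    (isOpen_restrictedTract hT hF.1.continuousOn)
  have himage : g '' halfPlaneOne = restrictedTract T F :=
    (hg.symm.bijOn hgm (isConformalIso_restrictedTract hF).2.mapsTo).image_eq
  rw [← himage]
  exact IsConnected.image ⟨⟨2, by simp⟩,
    (convex_halfSpace_re_gt 1).isPreconnected⟩ g hgc

/-- The boundary of the restricted tract is the properly embedded arc `F⁻¹(1 + iℝ)`. -/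
theorem exists_proper_arc_restrictedTract {T : Set ℂ} {F : ℂ → ℂ} (hT : IsOpen T)
    (hF : IsConformalIso F T {z : ℂ | 0 < z.re}) (hb : BoundedToLeft T F) :
    ∃ c : ℝ → ℂ, Continuous c ∧ Function.Injective c ∧
      Filter.Tendsto c (Filter.cocompact ℝ) (Filter.cocompact ℂ) ∧
      Set.range c = frontier (restrictedTract T F) := by
  obtain ⟨g, hgc, hgm, hg⟩ := hF.exists_inverse hT
  have hl : ∀ t : ℝ, 1 + t * Complex.I ∈ {z : ℂ | 0 < z.re} := fun t => by simp
  refine ⟨fun t => g (1 + t * Complex.I), hgc.comp_continuous (by fun_prop) hl,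
    fun s t h => one_add_mul_I_injective (hg.2.injOn (hl s) (hl t) h), ?_, ?_⟩
  · have hlim := tendsto_cocompact_one_add_mul_I
    rw [← Metric.cobounded_eq_cocompact (α := ℂ), ← tendsto_norm_atTop_iff_cobounded] at hlim ⊢
    rw [Filter.tendsto_atTop]
    intro x
    obtain ⟨C, hC⟩ := hb x
    filter_upwards [hlim.eventually_ge_atTop C] with t ht
    refine le_trans ?_ (Complex.re_le_norm _)
    by_contra! h
    have h1 := hC _ (hgm (hl t)) h
    rw [hg.2 (hl t)] at h1
    exact (h1.trans_le ht).false
  · rw [(isOpen_restrictedTract hT hF.1.continuousOn).frontier_eq, closure_restrictedTract hT hF hb]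
    ext z
    constructor
    · rintro ⟨t, rfl⟩
      have h1 := hg.2 (hl t)
      exact ⟨⟨hgm (hl t), by simp [h1]⟩, fun h => by simpa [h1, halfPlaneOne] using h.2⟩
    · rintro ⟨⟨hzT, hz⟩, hz'⟩
      have h1 : (F z).re = 1 := hz.antisymm' (not_lt.1 fun h => hz' ⟨hzT, h⟩)
      refine ⟨(F z).im, ?_⟩
      have h2 : 1 + ((F z).im : ℂ) * Complex.I = F z := by apply Complex.ext <;> simp [h1]
      simp only [h2, hg.1 hzT]

/-! ### Translates by multiples of `2πi` -/

/-- The translate of `S` by `2πim`. -/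
def stripTranslate (S : Set ℂ) (m : ℤ) : Set ℂ := {z : ℂ | z - 2 * π * Complex.I * m ∈ S}

theorem im_sub_two_pi_I_mul (z : ℂ) (m : ℤ) :
    (z - 2 * π * Complex.I * m).im = z.im - 2 * π * m := by simp

theorem re_sub_two_pi_I_mul (z : ℂ) (m : ℤ) :
    (z - 2 * π * Complex.I * m).re = z.re := by simp

/-- The strips `|Im z - 2πm| < π`, `m ∈ ℤ`, are pairwise disjoint. -/
theorem index_eq_of_abs_sub_lt {y : ℝ} {k m : ℤ} (hk : |y - 2 * π * k| < π)
    (hm : |y - 2 * π * m| < π) : k = m := by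
  rw [abs_lt] at hk hm
  have hpi := Real.pi_pos
  have h3 : (k : ℝ) < m + 1 := by nlinarith
  have h4 : (m : ℝ) < k + 1 := by nlinarith
  have h5 : k < m + 1 := by exact_mod_cast h3
  have h6 : m < k + 1 := by exact_mod_cast h4
  lia

/-- A connected subset of the union of all translates of a subset of the strip `|Im z| < π` lies in
a single translate. -/
theorem IsPreconnected.subset_stripTranslate {S C : Set ℂ} (hS : ∀ z ∈ S, |z.im| < π)
    (hC : IsPreconnected C) (hCS : ∀ z ∈ C, ∃ m, z ∈ stripTranslate S m) {z : ℂ} (hz : z ∈ C) {m : ℤ}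
    (hzm : z ∈ stripTranslate S m) : C ⊆ stripTranslate S m := by
  have hsub : C ⊆ {w : ℂ | |w.im - 2 * π * m| < π} := by
    refine hC.subset_left_of_subset_union (v := {w : ℂ | π < |w.im - 2 * π * m|})
      (isOpen_lt (by fun_prop) continuous_const) (isOpen_lt continuous_const (by fun_prop)) ?_ ?_ ?_
    · exact Set.disjoint_left.2 fun w h1 h2 =>
        lt_asymm (show |w.im - 2 * π * m| < π from h1) h2
    · intro w hw
      obtain ⟨k, hk⟩ := hCS w hw
      have h1 := hS _ hk
      rw [im_sub_two_pi_I_mul] at h1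
      by_cases hkm : k = m
      · exact Or.inl (hkm ▸ h1)
      · right
        have h2 : (1 : ℝ) ≤ |(k : ℝ) - m| := by
          exact_mod_cast Int.one_le_abs (sub_ne_zero.2 hkm)
        have h3 : |2 * π * ((k : ℝ) - m)| = 2 * π * |(k : ℝ) - m| := by
          rw [abs_mul, abs_of_pos Real.two_pi_pos]
        have h4 := abs_sub_abs_le_abs_sub (2 * π * ((k : ℝ) - m)) (-(w.im - 2 * π * k))
        rw [abs_neg, h3] at h4
        have h5 : 2 * π * ((k : ℝ) - m) - -(w.im - 2 * π * k) = w.im - 2 * π * m := by ring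
        rw [h5] at h4
        change π < |w.im - 2 * π * m|
        nlinarith [Real.pi_pos]
    · refine ⟨z, hz, ?_⟩
      have h1 := hS _ hzm
      rwa [im_sub_two_pi_I_mul] at h1
  intro w hw
  obtain ⟨k, hk⟩ := hCS w hw
  have h1 := hS _ hk
  rw [im_sub_two_pi_I_mul] at h1
  have h2 : |w.im - 2 * π * m| < π := hsub hw
  exact index_eq_of_abs_sub_lt h1 h2 ▸ hk

theorem isOpen_stripTranslate {S : Set ℂ} (hS : IsOpen S) (m : ℤ) : IsOpen (stripTranslate S m) :=
  hS.preimage (continuous_id.sub continuous_const)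

theorem closure_stripTranslate (S : Set ℂ) (m : ℤ) :
    closure (stripTranslate S m) = stripTranslate (closure S) m :=
  ((Homeomorph.subRight (2 * π * Complex.I * m)).preimage_closure S).symm

theorem frontier_stripTranslate (S : Set ℂ) (m : ℤ) :
    frontier (stripTranslate S m) = stripTranslate (frontier S) m :=
  ((Homeomorph.subRight (2 * π * Complex.I * m)).preimage_frontier S).symm

theorem isConnected_stripTranslate {S : Set ℂ} (hS : IsConnected S) (m : ℤ) :
    IsConnected (stripTranslate S m) :=
  (Homeomorph.subRight (2 * π * Complex.I * m)).isConnected_preimage.2 hS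

/-- The union of the translates of a closed subset of the strip is closed. -/
theorem isClosed_iUnion_stripTranslate {S : Set ℂ} (hS : ∀ z ∈ S, |z.im| < π) (hc : IsClosed S) :
    IsClosed (⋃ m, stripTranslate S m) := by
  refine LocallyFinite.isClosed_iUnion (fun z => ?_) fun m =>
    hc.preimage (continuous_id.sub continuous_const)
  refine ⟨Metric.ball z 1, Metric.ball_mem_nhds z one_pos, ?_⟩
  refine (Set.finite_Icc ⌊(z.im - 1 - π) / (2 * π)⌋ ⌈(z.im + 1 + π) / (2 * π)⌉).subset ?_
  rintro m ⟨w, hwm, hw⟩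
  have h1 := hS _ hwm
  rw [im_sub_two_pi_I_mul, abs_lt] at h1
  have h2 : |(w - z).im| < 1 :=
    (Complex.abs_im_le_norm _).trans_lt (by simpa [dist_eq_norm] using hw)
  rw [Complex.sub_im, abs_lt] at h2
  constructor
  · rw [← Int.cast_le (R := ℝ)]
    refine (Int.floor_le _).trans ?_
    rw [div_le_iff₀ Real.two_pi_pos]
    linarith
  · rw [← Int.cast_le (R := ℝ)]
    refine le_trans ?_ (Int.le_ceil _)
    rw [le_div_iff₀ Real.two_pi_pos]
    linarith

/-! ### The periodic extension belongs to `B_log^p` and is of disjoint type -/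

section PeriodicExtension

variable {T : Set ℂ} {F : ℂ → ℂ}

theorem closure_periodicDomain_subset (hT : IsOpen T) (hF : IsConformalIso F T {z : ℂ | 0 < z.re})
    (hb : BoundedToLeft T F) (hS : ∀ z ∈ T, |z.im| < π) {z : ℂ}
    (hz : z ∈ closure (periodicDomain T F)) : ∃ m, z ∈ stripTranslate (closedTract T F) m := by
  have hcl := isClosed_iUnion_stripTranslate (fun z hz => hS z hz.1)
    (isClosed_closedTract hT hF hb)
  have hsub : periodicDomain T F ⊆ ⋃ m, stripTranslate (closedTract T F) m := by
    rintro w ⟨m, hm⟩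
    exact Set.mem_iUnion.2 ⟨m, restrictedTract_subset_closedTract T F hm⟩
  exact Set.mem_iUnion.1 (hcl.closure_subset_iff.2 hsub hz)

/-- The tracts of the periodic extension are the translates of the restricted tract. -/
theorem connectedComponentIn_periodicDomain (hT : IsOpen T)
    (hF : IsConformalIso F T {z : ℂ | 0 < z.re}) (hS : ∀ z ∈ T, |z.im| < π) {z : ℂ} {m : ℤ}
    (hz : z ∈ stripTranslate (restrictedTract T F) m) :
    connectedComponentIn (periodicDomain T F) z = stripTranslate (restrictedTract T F) m := by
  refine Set.Subset.antisymm ?_ ?_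
  · exact isPreconnected_connectedComponentIn.subset_stripTranslate (fun w hw => hS w hw.1)
      (fun w hw => show ∃ k, w ∈ stripTranslate (restrictedTract T F) k from
        connectedComponentIn_subset (periodicDomain T F) z hw) (mem_connectedComponentIn ⟨m, hz⟩) hz
  · exact (isConnected_stripTranslate
      (isConnected_restrictedTract hT hF) m).isPreconnected.subset_connectedComponentIn hz
      fun w hw => ⟨m, hw⟩

theorem periodicExtension_eq (hS : ∀ z ∈ T, |z.im| < π) {z : ℂ} {m : ℤ}
    (hz : z ∈ stripTranslate T m) :
    periodicExtension F z = F (z - 2 * π * Complex.I * m) :=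
  periodicExtension_apply F z m (hS _ hz)

theorem continuousAt_periodicExtension (hT : IsOpen T) (hF : ContinuousOn F T)
    (hS : ∀ z ∈ T, |z.im| < π) {z : ℂ} {m : ℤ} (hz : z ∈ stripTranslate T m) :
    ContinuousAt (periodicExtension F) z := by
  have h1 : ContinuousAt (fun w : ℂ => F (w - 2 * π * Complex.I * m)) z :=
    ContinuousAt.comp (f := fun w : ℂ => w - 2 * π * Complex.I * m)
      (hF.continuousAt (hT.mem_nhds hz)) (by fun_prop)
  refine h1.congr ?_
  filter_upwards [(isOpen_stripTranslate hT m).mem_nhds hz] with w hw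
  exact (periodicExtension_eq hS hw).symm

/-- On the closure of the domain, the continuous extension is again the periodic extension. -/
theorem extendFrom_periodicExtension (hT : IsOpen T)
    (hF : IsConformalIso F T {z : ℂ | 0 < z.re}) (hb : BoundedToLeft T F)
    (hS : ∀ z ∈ T, |z.im| < π) {z : ℂ} (hz : z ∈ closure (periodicDomain T F)) :
    extendFrom (periodicDomain T F) (periodicExtension F) z = periodicExtension F z := by
  obtain ⟨m, hm⟩ := closure_periodicDomain_subset hT hF hb hS hz
  exact extendFrom_eq hz
    (continuousAt_periodicExtension hT hF.1.continuousOn hS (m := m) hm.1).continuousWithinAt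

theorem stripTranslate_injOn_exp {S : Set ℂ} (hS : ∀ z ∈ S, |z.im| < π) (m : ℤ) :
    Set.InjOn Complex.exp (stripTranslate S m) := by
  intro z hz w hw h
  have hp (u : ℂ) : Complex.exp (u - 2 * π * Complex.I * m) = Complex.exp u := by
    rw [Complex.exp_eq_exp_iff_exists_int]
    exact ⟨-m, by push_cast; ring⟩
  have h1 := abs_lt.1 (hS _ hz)
  have h2 := abs_lt.1 (hS _ hw)
  have h3 := Complex.exp_inj_of_neg_pi_lt_of_le_pi h1.1 h1.2.le h2.1 h2.2.le
    ((hp z).trans (h.trans (hp w).symm))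
  exact sub_left_injective h3

theorem isConformalIso_periodicExtension (hF : IsConformalIso F T {z : ℂ | 0 < z.re})
    (hS : ∀ z ∈ T, |z.im| < π) (m : ℤ) :
    IsConformalIso (periodicExtension F) (stripTranslate (restrictedTract T F) m)
      halfPlaneOne := by
  have hF' := isConformalIso_restrictedTract hF
  have heq : Set.EqOn (fun z => F (z - 2 * π * Complex.I * m)) (periodicExtension F)
      (stripTranslate (restrictedTract T F) m) := fun z hz =>
    (periodicExtension_eq (T := T) hS hz.1).symm
  refine ⟨?_, ?_⟩
  · refine DifferentiableOn.congr ?_ fun z hz => (heq hz).symm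
    exact hF'.1.comp (by fun_prop) fun z hz => hz
  · refine Set.BijOn.congr ?_ heq
    refine hF'.2.comp ⟨fun z hz => hz, sub_left_injective.injOn, fun z hz => ?_⟩
    exact ⟨z + 2 * π * Complex.I * m, by simpa [stripTranslate] using hz, by simp⟩

theorem isBlogPeriodic_periodicExtension (hT : IsOpen T)
    (hF : IsConformalIso F T {z : ℂ | 0 < z.re}) (hb : BoundedToLeft T F)
    (hS : ∀ z ∈ T, |z.im| < π) (hre : BddBelow (Complex.re '' T)) :
    IsBlogPeriodic (periodicDomain T F) halfPlaneOne (periodicExtension F) := by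
  have hS' : ∀ z ∈ restrictedTract T F, |z.im| < π := fun z hz => hS z hz.1
  have hcomp {z : ℂ} {m : ℤ} (hz : z ∈ stripTranslate (restrictedTract T F) m) :=
    connectedComponentIn_periodicDomain hT hF hS hz
  have hopen := isOpen_restrictedTract hT hF.1.continuousOn
  obtain ⟨c, hc, hcinj, hclim, hcrange⟩ := exists_proper_arc_restrictedTract hT hF hb
  have hshift (z : ℂ) (m : ℤ) :
      z + 2 * π * Complex.I - 2 * π * Complex.I * ((m + 1 : ℤ) : ℂ) =
        z - 2 * π * Complex.I * m := by push_cast; ring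
  have habove : ∀ m, ¬ BddAbove (Complex.re '' stripTranslate (restrictedTract T F) m) := by
    rintro m ⟨x, hx⟩
    obtain ⟨C, hC⟩ := hb (x + 1)
    obtain ⟨z, hz, hzC⟩ := (isConformalIso_periodicExtension hF hS m).2.surjOn
      (show ((max C 2 : ℝ) : ℂ) ∈ halfPlaneOne by simp [halfPlaneOne])
    have h1 : z.re ≤ x := hx ⟨z, hz, rfl⟩
    have h2 := hC _ hz.1 (by rw [re_sub_two_pi_I_mul]; linarith)
    rw [← periodicExtension_eq (F := F) hS hz.1, hzC, Complex.norm_real] at h2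
    exact ((le_max_left C 2).trans (le_abs_self _)).not_gt h2
  refine
    { range_jordan := isJordanDomain_halfPlaneOne
      range_periodic := fun z => by simp [halfPlaneOne]
      range_halfPlane := ⟨1, subset_rfl⟩
      tract_jordan := ?_
      tract_unbounded := ?_
      tract_bddBelow := ?_
      tract_not_bddAbove := ?_
      disjoint_closures := ?_
      accumulate_infty := ?_
      conformal := ?_
      extends_closure := ?_
      exp_injOn := ?_
      domain_periodic := ?_
      periodic := ?_ }
  · rintro z ⟨m, hm⟩
    rw [hcomp hm]
    have hadd : Filter.Tendsto (fun w : ℂ => w + 2 * π * Complex.I * m) (Filter.cocompact ℂ)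
        (Filter.cocompact ℂ) :=
      (Homeomorph.addRight (2 * π * Complex.I * (m : ℂ))).isClosedEmbedding.tendsto_cocompact
    refine isJordanDomain_of_proper_arc (c := fun t => c t + 2 * π * Complex.I * m)
      (isOpen_stripTranslate hopen m)
      (isConnected_stripTranslate (isConnected_restrictedTract hT hF) m) (by fun_prop)
      (fun s t h => hcinj (add_right_cancel h)) (hadd.comp hclim) ?_
    rw [frontier_stripTranslate, ← hcrange]
    ext w
    constructor
    · rintro ⟨t, rfl⟩
      exact ⟨t, by simp⟩
    · rintro ⟨t, ht⟩
      exact ⟨t, by simp [ht]⟩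
  · rintro z ⟨m, hm⟩ hbd
    rw [hcomp hm] at hbd
    apply habove m
    obtain ⟨x, hx⟩ := hbd.exists_norm_le
    refine ⟨x, ?_⟩
    rintro _ ⟨w, hw, rfl⟩
    exact (Complex.re_le_norm w).trans (hx w hw)
  · rintro z ⟨m, hm⟩
    rw [hcomp hm]
    obtain ⟨x, hx⟩ := hre
    refine ⟨x, ?_⟩
    rintro _ ⟨w, hw, rfl⟩
    rw [← re_sub_two_pi_I_mul w m]
    exact hx ⟨_, hw.1, rfl⟩
  · rintro z ⟨m, hm⟩
    rw [hcomp hm]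
    exact habove m
  · rintro z ⟨m, hm⟩ w ⟨k, hk⟩ hne
    rw [hcomp hm, hcomp hk] at hne ⊢
    rw [closure_stripTranslate, closure_stripTranslate, closure_restrictedTract hT hF hb,
      Set.disjoint_left]
    intro u hum huk
    apply hne
    have h1 := hS _ hum.1
    have h2 := hS _ huk.1
    rw [im_sub_two_pi_I_mul] at h1 h2
    rw [index_eq_of_abs_sub_lt h1 h2]
  · intro z hzU hne
    choose m hm using hzU
    have hinj : Function.Injective m := by
      intro n k h
      by_contra hnk
      apply hne n k hnk
      rw [hcomp (hm n), hcomp (hm k), h]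
    rw [← tendsto_norm_atTop_iff_cobounded]
    have hlim : Filter.Tendsto (fun n => ‖m n‖) Filter.atTop Filter.atTop := by
      rw [tendsto_norm_atTop_iff_cobounded, Metric.cobounded_eq_cocompact,
        Filter.cocompact_eq_cofinite, ← Nat.cofinite_eq_atTop]
      exact hinj.tendsto_cofinite
    have hlim' : Filter.Tendsto (fun n => 2 * π * ‖m n‖ - π) Filter.atTop Filter.atTop :=
      Filter.tendsto_atTop_add_const_right _ _ (hlim.const_mul_atTop Real.two_pi_pos)
    refine Filter.tendsto_atTop_mono (fun n => ?_) hlim'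
    refine le_trans ?_ (Complex.abs_im_le_norm (z n))
    have h1 := hS _ (hm n).1
    rw [im_sub_two_pi_I_mul] at h1
    have h2 := abs_sub_abs_le_abs_sub (2 * π * (m n : ℝ)) (z n).im
    rw [abs_sub_comm, abs_mul, abs_of_pos Real.two_pi_pos] at h2
    rw [Int.norm_eq_abs]
    linarith
  · rintro z ⟨m, hm⟩
    rw [hcomp hm]
    exact isConformalIso_periodicExtension hF hS m
  · refine ⟨periodicExtension F, fun z hz => ?_, fun z _ => rfl⟩
    obtain ⟨m, hm⟩ := closure_periodicDomain_subset hT hF hb hS hz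
    exact (continuousAt_periodicExtension hT hF.1.continuousOn hS (m := m) hm.1).continuousWithinAt
  · rintro z ⟨m, hm⟩
    rw [hcomp hm]
    exact stripTranslate_injOn_exp hS' m
  · intro z
    constructor
    · rintro ⟨m, hm⟩
      refine ⟨m - 1, ?_⟩
      rw [← hshift, sub_add_cancel]
      exact hm
    · rintro ⟨m, hm⟩
      refine ⟨m + 1, ?_⟩
      rw [hshift]
      exact hm
  · rintro z ⟨m, hm⟩
    have h1 : z + 2 * π * Complex.I ∈ stripTranslate T (m + 1) := by
      rw [stripTranslate, Set.mem_ofPred_eq, hshift]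
      exact hm.1
    rw [periodicExtension_eq hS h1, periodicExtension_eq (m := m) hS hm.1, hshift]

theorem isDisjointType_periodicDomain (hT : IsOpen T)
    (hF : IsConformalIso F T {z : ℂ | 0 < z.re}) (hb : BoundedToLeft T F)
    (hS : ∀ z ∈ T, |z.im| < π) (hre : ∀ z ∈ T, 1 < z.re) :
    IsDisjointType (periodicDomain T F) halfPlaneOne := by
  intro z hz
  obtain ⟨m, hm⟩ := closure_periodicDomain_subset hT hF hb hS hz
  have h1 := hre _ hm.1
  rwa [re_sub_two_pi_I_mul] at h1

end PeriodicExtension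

/-! ### Geometry of the tract -/

namespace TractDatum

variable (ξ : TractDatum)

theorem R_lt_r_of_lt {j k : ℕ} (h : j < k) : ξ.R j < ξ.r k := by
  induction k, h using Nat.le_induction with
  | base => linarith [ξ.R_r j]
  | succ k _ ih => linarith [ξ.r_R k, ξ.R_r k]

theorem add_six_lt_r (j : ℕ) : (j : ℝ) + 6 < ξ.r j := by
  induction j with
  | zero => simpa using ξ.r_zero
  | succ j ih =>
    push_cast
    linarith [ξ.r_R j, ξ.R_r j]

theorem eq_of_mem_Icc {x : ℝ} {j k : ℕ} (hj : x ∈ Set.Icc (ξ.r j) (ξ.R j))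
    (hk : x ∈ Set.Icc (ξ.r k) (ξ.R k)) : k = j := by
  rcases lt_trichotomy k j with h | h | h
  · exact absurd (ξ.R_lt_r_of_lt h) (by linarith [hj.1, hk.2])
  · exact h
  · exact absurd (ξ.R_lt_r_of_lt h) (by linarith [hk.1, hj.2])

theorem re_mem_Icc_of_mem_slits {z : ℂ} (hz : z ∈ ξ.slits) :
    ∃ j, z.re ∈ Set.Icc (ξ.r j) (ξ.R j) ∧
      (z.re = ξ.r j ∨ π / 3 ≤ z.im ∨ z.im = -(π / 3) ∨ z.re = ξ.R j) := by
  obtain ⟨j, hj⟩ := Set.mem_iUnion.1 hz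
  have h1 := ξ.r_R j
  have h2 := ξ.r_τ j
  have h3 := ξ.τ_R j
  have hpi := Real.pi_pos
  have hε := ξ.ε_pos j
  refine ⟨j, ?_⟩
  rcases hj with (((((⟨h, -⟩ | ⟨h, h'⟩) | ⟨h, h'⟩) | ⟨h, -⟩) | ⟨h, h'⟩) | ⟨h, h'⟩)
  · exact ⟨⟨h.ge, by linarith⟩, Or.inl h⟩
  · exact ⟨⟨h.1, by linarith [h.2]⟩, Or.inr (Or.inl h'.ge)⟩
  · exact ⟨⟨by linarith [h.1], h.2⟩, Or.inr (Or.inr (Or.inl h'))⟩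
  · exact ⟨⟨by linarith, h.le⟩, Or.inr (Or.inr (Or.inr h))⟩
  · exact ⟨⟨by linarith, by linarith⟩, Or.inr (Or.inl h'.1)⟩
  · exact ⟨⟨by linarith, by linarith⟩, Or.inr (Or.inl (by nlinarith [h'.1]))⟩

theorem isClosed_slits : IsClosed ξ.slits := by
  refine LocallyFinite.isClosed_iUnion (fun z => ?_) fun j => ?_
  · refine ⟨{w : ℂ | w.re < z.re + 1},
      (isOpen_lt Complex.continuous_re continuous_const).mem_nhds (by simp), ?_⟩
    obtain ⟨n, hn⟩ := exists_nat_gt (z.re + 1)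
    refine (Set.finite_lt_nat n).subset ?_
    rintro j ⟨w, hw, hwz⟩
    rw [Set.mem_ofPred_eq] at hwz ⊢
    have h0 := ξ.add_six_lt_r j
    have h1 := ξ.r_R j
    have h2 := ξ.r_τ j
    have h3 : ξ.r j ≤ w.re := by
      rcases hw with (((((⟨h, -⟩ | ⟨h, -⟩) | ⟨h, -⟩) | ⟨h, -⟩) | ⟨h, -⟩) | ⟨h, -⟩)
      · exact h.ge
      · exact h.1
      · linarith [h.1]
      · linarith
      · linarith
      · linarith
    exact_mod_cast (show (j : ℝ) < n by linarith)
  · have hre (a : ℝ) : IsClosed {z : ℂ | z.re = a} :=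
      isClosed_eq Complex.continuous_re continuous_const
    have him (a : ℝ) : IsClosed {z : ℂ | z.im = a} :=
      isClosed_eq Complex.continuous_im continuous_const
    have hre' (a b : ℝ) : IsClosed {z : ℂ | z.re ∈ Set.Icc a b} :=
      isClosed_Icc.preimage Complex.continuous_re
    have him' (a b : ℝ) : IsClosed {z : ℂ | z.im ∈ Set.Icc a b} :=
      isClosed_Icc.preimage Complex.continuous_im
    exact ((((((hre _).inter (him' _ _)).union ((hre' _ _).inter (him _))).union
      ((hre' _ _).inter (him _))).union ((hre _).inter (him' _ _))).union
      ((hre _).inter (him' _ _))).union ((hre _).inter (him' _ _))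

theorem isOpen_tract : IsOpen ξ.tract := by
  refine IsOpen.sdiff ?_ ξ.isClosed_slits
  exact (isOpen_lt continuous_const Complex.continuous_re).inter
    (isOpen_lt Complex.continuous_im.abs continuous_const)

theorem five_mem_tract : (5 : ℂ) ∈ ξ.tract := by
  refine ⟨⟨by norm_num, by simpa using Real.pi_pos⟩, fun h => ?_⟩
  obtain ⟨j, hj, -⟩ := ξ.re_mem_Icc_of_mem_slits h
  have h1 := ξ.add_six_lt_r j
  have h2 : ξ.r j ≤ 5 := by simpa using hj.1
  have h3 : (0 : ℝ) ≤ j := j.cast_nonneg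
  linarith

variable {ξ}

theorem im_ne_of_mem_tract {z : ℂ} (hz : z ∈ ξ.tract) {j : ℕ} (h1 : ξ.r j + 1 ≤ z.re)
    (h2 : z.re ≤ ξ.R j) : z.im ≠ -(π / 3) := fun h =>
  hz.2 (Set.mem_iUnion.2 ⟨j, Or.inl (Or.inl (Or.inl (Or.inr ⟨⟨h1, h2⟩, h⟩)))⟩)

theorem im_lt_of_mem_tract {z : ℂ} (hz : z ∈ ξ.tract) {j : ℕ} (h : z.re = ξ.R j) :
    z.im < -(π / 3) := by
  by_contra! h1
  exact hz.2 (Set.mem_iUnion.2 ⟨j, Or.inl (Or.inl (Or.inr ⟨h, h1, (abs_lt.1 hz.1.2).2.le⟩))⟩)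

/-- Beyond `Re z = r_j + 1`, the tract falls into the open set reached before the turn from the
middle channel to the lower one, and the open set reached after it. -/
theorem before_or_after_of_mem_tract {z : ℂ} (hz : z ∈ ξ.tract) {j : ℕ} (h : ξ.r j + 1 ≤ z.re) :
    (z.re < ξ.R j ∧ -(π / 3) < z.im) ∨ (z.im < -(π / 3) ∨ ξ.R j < z.re) := by
  rcases lt_trichotomy z.re (ξ.R j) with h1 | h1 | h1
  · rcases lt_trichotomy z.im (-(π / 3)) with h2 | h2 | h2
    · exact Or.inr (Or.inl h2)
    · exact absurd h2 (im_ne_of_mem_tract hz h h1.le)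
    · exact Or.inl ⟨h1, h2⟩
  · exact Or.inr (Or.inl (im_lt_of_mem_tract hz h1))
  · exact Or.inr (Or.inr h1)

/-- A connected subset of the tract that joins the middle channel of the `j`-th wiggle to the lower
one has a point at the left end of the wiggle, where the two channels are connected. -/
theorem exists_re_lt_of_isPreconnected {C : Set ℂ} (hC : IsPreconnected C) (hCT : C ⊆ ξ.tract)
    {j : ℕ} {z w : ℂ} (hz : z ∈ C) (hzj : z.re < ξ.R j) (hz' : -(π / 3) < z.im) (hw : w ∈ C)
    (hw' : w.im < -(π / 3)) : ∃ v ∈ C, v.re < ξ.r j + 1 := by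
  by_contra! h
  have hsub : C ⊆ {z : ℂ | z.re < ξ.R j} ∩ {z : ℂ | -(π / 3) < z.im} :=
    hC.subset_left_of_subset_union (v := {z : ℂ | z.im < -(π / 3)} ∪ {z : ℂ | ξ.R j < z.re})
      ((isOpen_lt Complex.continuous_re continuous_const).inter
        (isOpen_lt continuous_const Complex.continuous_im))
      ((isOpen_lt Complex.continuous_im continuous_const).union
        (isOpen_lt continuous_const Complex.continuous_re))
      (Set.disjoint_left.2 fun u hu hu' => hu'.elim (fun h => lt_asymm (b := u.im) hu.2 h)
        fun h => lt_asymm (b := ξ.R j) hu.1 h)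
      (fun u hu => before_or_after_of_mem_tract (hCT hu) (h u hu)) ⟨z, hz, hzj, hz'⟩
  exact lt_asymm hw' (hsub hw).2

/-- An open set whose intersection with the tract is the part that precedes the vertical crosscut
`Re z = x` of the lower channel of the `j`-th wiggle, where `r_j + 1 ≤ x < R_j`. -/
def beforeCrosscut (ξ : TractDatum) (j : ℕ) (x : ℝ) : Set ℂ :=
  {z : ℂ | (z.re < ξ.R j ∧ -(π / 3) < z.im) ∨ z.re < x}

/-- An open set whose intersection with the tract is the part that follows the vertical crosscut
`Re z = x` of the lower channel of the `j`-th wiggle, where `r_j + 1 ≤ x < R_j`. -/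
def afterCrosscut (ξ : TractDatum) (j : ℕ) (x : ℝ) : Set ℂ :=
  {z : ℂ | (x < z.re ∧ z.im < -(π / 3)) ∨ ξ.R j < z.re}

/-- The vertical crosscut `Re z = x` of the lower channel of a wiggle. -/
def lowerCrosscut (x : ℝ) : Set ℂ := {z : ℂ | z.re = x ∧ z.im ∈ Set.Ioo (-π) (-(π / 3))}

theorem isOpen_beforeCrosscut (j : ℕ) (x : ℝ) : IsOpen (ξ.beforeCrosscut j x) :=
  ((isOpen_lt Complex.continuous_re continuous_const).inter
    (isOpen_lt continuous_const Complex.continuous_im)).union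
    (isOpen_lt Complex.continuous_re continuous_const)

theorem isOpen_afterCrosscut (j : ℕ) (x : ℝ) : IsOpen (ξ.afterCrosscut j x) :=
  ((isOpen_lt continuous_const Complex.continuous_re).inter
    (isOpen_lt Complex.continuous_im continuous_const)).union
    (isOpen_lt continuous_const Complex.continuous_re)

theorem disjoint_beforeCrosscut_afterCrosscut {j : ℕ} {x : ℝ} (hx : x < ξ.R j) :
    Disjoint (ξ.beforeCrosscut j x) (ξ.afterCrosscut j x) := by
  rw [Set.disjoint_left]
  rintro z (⟨h1, h2⟩ | h1) (⟨h3, h4⟩ | h3) <;> linarith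

theorem isPreconnected_lowerCrosscut (x : ℝ) : IsPreconnected (lowerCrosscut x) :=
  ((convex_hyperplane (𝕜 := ℝ) Complex.reLm.isLinear x).inter
    ((convex_Ioo (-π) (-(π / 3))).linear_preimage Complex.imLm)).isPreconnected

theorem lowerCrosscut_subset_tract {j : ℕ} {x : ℝ} (h1 : ξ.r j < x) (h2 : x < ξ.R j) :
    lowerCrosscut x ⊆ ξ.tract := by
  rintro z ⟨rfl, hz⟩
  have hpi := Real.pi_pos
  have h3 := ξ.add_six_lt_r j
  have h4 : (0 : ℝ) ≤ j := j.cast_nonneg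
  refine ⟨⟨by linarith, abs_lt.2 ⟨hz.1, by linarith [hz.2]⟩⟩, fun h => ?_⟩
  obtain ⟨k, hk, hk'⟩ := ξ.re_mem_Icc_of_mem_slits h
  obtain rfl := ξ.eq_of_mem_Icc ⟨h1.le, h2.le⟩ hk
  rcases hk' with h | h | h | h <;> linarith [hz.2]

theorem tract_subset_crosscut_union {j : ℕ} {x : ℝ} (h1 : ξ.r j + 1 ≤ x) {z : ℂ}
    (hz : z ∈ ξ.tract) (hzx : z ∉ lowerCrosscut x) :
    z ∈ ξ.beforeCrosscut j x ∪ ξ.afterCrosscut j x := by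
  rcases lt_trichotomy z.re x with h | h | h
  · exact Or.inl (Or.inr h)
  · rcases before_or_after_of_mem_tract hz (h1.trans h.ge) with h2 | h2 | h2
    · exact Or.inl (Or.inl h2)
    · exact absurd ⟨h, (abs_lt.1 hz.1.2).1, h2⟩ hzx
    · exact Or.inr (Or.inr h2)
  · rcases before_or_after_of_mem_tract hz (h1.trans h.le) with h2 | h2 | h2
    · exact Or.inl (Or.inl h2)
    · exact Or.inr (Or.inl ⟨h, h2⟩)
    · exact Or.inr (Or.inr h2)

end TractDatum

/-! ### Vertical geodesics separate the tract -/

theorem isPreconnected_halfPlane_inter_exterior {s : ℝ} (hs : 0 < s) :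
    IsPreconnected {w : ℂ | 0 < w.re ∧ s < ‖w‖} := by
  have himage : Complex.exp '' ({u : ℂ | Real.log s < u.re} ∩
      {u : ℂ | u.im ∈ Set.Ioo (-(π / 2)) (π / 2)}) =
      {w : ℂ | 0 < w.re ∧ s < ‖w‖} := by
    ext w
    constructor
    · rintro ⟨u, ⟨hu, hu'⟩, rfl⟩
      refine ⟨?_, ?_⟩
      · rw [Complex.exp_re]
        exact mul_pos (Real.exp_pos _) (Real.cos_pos_of_mem_Ioo hu')
      · rwa [Complex.norm_exp, ← Real.log_lt_iff_lt_exp hs]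
    · rintro ⟨hw, hws⟩
      have hw0 : w ≠ 0 := norm_pos_iff.1 (hs.trans hws)
      refine ⟨Complex.log w, ⟨?_, ?_⟩, Complex.exp_log hw0⟩
      · rw [Set.mem_ofPred_eq, Complex.log_re]
        exact Real.log_lt_log hs hws
      · rw [Set.mem_ofPred_eq, Complex.log_im]
        exact abs_lt.1 (Complex.abs_arg_lt_pi_div_two_iff.2 (Or.inl hw))
  rw [← himage]
  exact ((convex_halfSpace_re_gt _).inter ((convex_Ioo _ _).linear_preimage
    Complex.imLm)).isPreconnected.image _ Complex.continuous_exp.continuousOn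

theorem isPreconnected_halfPlane_inter_ball (s : ℝ) :
    IsPreconnected {w : ℂ | 0 < w.re ∧ ‖w‖ < s} := by
  have h : {w : ℂ | 0 < w.re ∧ ‖w‖ < s} = {w : ℂ | 0 < w.re} ∩ Metric.ball 0 s := by
    ext w
    simp
  rw [h]
  exact ((convex_halfSpace_re_gt 0).inter (convex_ball 0 s)).isPreconnected

namespace TractDatum

variable {ξ : TractDatum} {F : ℂ → ℂ}

/-- A connected subset `D` of the half-plane whose preimage avoids a crosscut of the lower channel
and meets the side before it has no boundary points whose preimages lie after the crosscut. -/
theorem false_of_disjoint_lowerCrosscut (hF : IsNormalisedMap ξ.tract F) {j : ℕ} {x : ℝ}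
    (hx : ξ.r j + 1 ≤ x) (hxR : x < ξ.R j) {D : Set ℂ} (hD : IsPreconnected D)
    (hDH : D ⊆ {w : ℂ | 0 < w.re}) {q : ℂ} (hq : q ∈ ξ.tract) (hqD : F q ∈ closure D)
    (hqx : q ∈ ξ.afterCrosscut j x) (hσ : ∀ z ∈ lowerCrosscut x, F z ∉ D) {z : ℂ}
    (hz : z ∈ ξ.tract) (hzD : F z ∈ D) (hzx : z ∈ ξ.beforeCrosscut j x) : False := by
  obtain ⟨g, hgc, hgm, hg⟩ := hF.conformal.exists_inverse ξ.isOpen_tract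
  have hC : IsPreconnected (g '' D) := hD.image g (hgc.mono hDH)
  have hdisj := disjoint_beforeCrosscut_afterCrosscut (ξ := ξ) hxR
  have hsub : g '' D ⊆ ξ.beforeCrosscut j x := by
    refine hC.subset_left_of_subset_union (isOpen_beforeCrosscut j x) (isOpen_afterCrosscut j x)
      hdisj ?_ ⟨z, ⟨F z, hzD, hg.1 hz⟩, hzx⟩
    rintro _ ⟨w, hw, rfl⟩
    refine tract_subset_crosscut_union hx (hgm (hDH hw)) fun h => hσ _ h ?_
    rwa [hg.2 (hDH hw)]
  have h1 := ((hgc (F q) (hF.conformal.2.mapsTo hq)).mono hDH).mem_closure_image hqD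
  rw [hg.1 hq] at h1
  obtain ⟨u, hu, hu'⟩ := mem_closure_iff.1 h1 _ (isOpen_afterCrosscut j x) hqx
  exact Set.disjoint_left.1 hdisj (hsub hu') hu

/-- If the vertical geodesic of radius `s` lies after a crosscut of the lower channel, then so does
everything that `F` maps outside the disc of radius `s`. -/
theorem norm_lt_of_mem_beforeCrosscut (hF : IsNormalisedMap ξ.tract F) {j : ℕ} {x : ℝ}
    (hx : ξ.r j + 1 ≤ x) (hxR : x < ξ.R j) {s : ℝ} (hs : 5 < s)
    (hΓ : ξ.verticalGeodesic F s ⊆ ξ.afterCrosscut j x) {z : ℂ} (hz : z ∈ ξ.tract)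
    (hzx : z ∈ ξ.beforeCrosscut j x) : ‖F z‖ < s := by
  have hs0 : 0 < s := by linarith
  have hdisj := disjoint_beforeCrosscut_afterCrosscut (ξ := ξ) hxR
  obtain ⟨q, hq, hqs⟩ := hF.conformal.2.surjOn (show (s : ℂ) ∈ {w : ℂ | 0 < w.re} by simpa)
  have hqx : q ∈ ξ.afterCrosscut j x := hΓ ⟨hq, by rw [hqs, Complex.norm_of_nonneg hs0.le]⟩
  have hσT := lowerCrosscut_subset_tract (ξ := ξ) (by linarith : ξ.r j < x) hxR
  by_contra! hzs
  have hzs' : s < ‖F z‖ := hzs.lt_of_ne fun h =>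
    Set.disjoint_left.1 hdisj hzx (hΓ ⟨hz, h.symm⟩)
  -- The crosscut is connected and misses the geodesic, so it lies on one side of it; the other
  -- side is then connected in the complement of the crosscut.
  by_cases hσ : ∃ p ∈ lowerCrosscut x, ‖F p‖ < s
  · have hσs : ∀ p ∈ lowerCrosscut x, ‖F p‖ < s := by
      obtain ⟨p, hp, hps⟩ := hσ
      intro p' hp'
      by_contra! h
      obtain ⟨v, hv, hvs⟩ := (isPreconnected_lowerCrosscut x).intermediate_value hp hp'
        (hF.conformal.1.continuousOn.mono hσT).norm ⟨hps.le, h⟩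
      rcases hΓ ⟨hσT hv, hvs⟩ with h2 | h2
      · exact h2.1.ne' hv.1
      · exact (hxR.trans h2).ne' hv.1
    refine false_of_disjoint_lowerCrosscut hF hx hxR (isPreconnected_halfPlane_inter_exterior hs0)
      (fun w hw => hw.1) hq ?_ hqx (fun p hp h => lt_asymm (hσs p hp) h.2) hz
      ⟨hF.conformal.2.mapsTo hz, hzs'⟩ hzx
    rw [hqs]
    refine map_mem_closure Complex.continuous_ofReal (s := Set.Ioi s) (by simp) fun t ht => ?_
    have ht0 : 0 < t := hs0.trans ht
    exact ⟨by simpa, by rw [Complex.norm_of_nonneg ht0.le]; exact ht⟩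
  · push Not at hσ
    have h5x : (5 : ℂ) ∈ ξ.beforeCrosscut j x := by
      have h1 := ξ.add_six_lt_r j
      have h2 : (0 : ℝ) ≤ j := j.cast_nonneg
      exact Or.inr (by simpa using (by linarith : (5 : ℝ) < x))
    refine false_of_disjoint_lowerCrosscut hF hx hxR (isPreconnected_halfPlane_inter_ball s)
      (fun w hw => hw.1) hq ?_ hqx (fun p hp h => (hσ p hp).not_gt h.2) ξ.five_mem_tract
      ⟨by simp [hF.map_five], by simpa [hF.map_five] using hs⟩ h5x
    rw [hqs]
    refine map_mem_closure Complex.continuous_ofReal (s := Set.Ioo 0 s) ?_ fun t ht => ?_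
    · rw [closure_Ioo hs0.ne]
      exact ⟨hs0.le, le_rfl⟩
    · exact ⟨by simpa using ht.1, by rw [Complex.norm_of_nonneg ht.1.le]; exact ht.2⟩

/-- If, for every `j`, some vertical geodesic lies after a crosscut of the lower channel of the
`j`-th wiggle, then `F` is bounded on every part of the tract left of a vertical line. -/
theorem boundedToLeft (hF : IsNormalisedMap ξ.tract F) {x s : ℕ → ℝ}
    (hx : ∀ j, ξ.r j + 1 ≤ x j) (hxR : ∀ j, x j < ξ.R j) (hs : ∀ j, 5 < s j)
    (hΓ : ∀ j, ξ.verticalGeodesic F (s j) ⊆ ξ.afterCrosscut j (x j)) :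
    BoundedToLeft ξ.tract F := by
  intro y
  obtain ⟨j, hj⟩ := exists_nat_gt y
  refine ⟨s j, fun z hz hzy => norm_lt_of_mem_beforeCrosscut hF (hx j) (hxR j) (hs j) (hΓ j) hz
    (Or.inr ?_)⟩
  linarith [ξ.add_six_lt_r j, hx j]

end TractDatum

/-! ### Counting crossings -/

/-- On `[s, t]`, the function `f` passes from values at most `a` to values at least `b`, or
conversely. -/
def Crosses (f : ℝ → ℝ) (a b s t : ℝ) : Prop :=
  (f s ≤ a ∧ b ≤ f t) ∨ (b ≤ f s ∧ f t ≤ a)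

/-- `[x, y]` contains `n` successive intervals without common interior points on each of which `f`
crosses `[a, b]`. -/
inductive HasCrossings (f : ℝ → ℝ) (a b : ℝ) : ℕ → ℝ → ℝ → Prop
  | zero {x y : ℝ} : x ≤ y → HasCrossings f a b 0 x y
  | succ {n : ℕ} {x s t y : ℝ} : x ≤ s → s ≤ t → Crosses f a b s t → HasCrossings f a b n t y →
      HasCrossings f a b (n + 1) x y

namespace HasCrossings

variable {f f' : ℝ → ℝ} {a b a' b' : ℝ}

theorem append {n m : ℕ} {x y z : ℝ} (h : HasCrossings f a b n x y)
    (h' : HasCrossings f a b m y z) : HasCrossings f a b (n + m) x z := by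
  induction h with
  | zero hxy =>
    rw [zero_add]
    cases h' with
    | zero h => exact zero (hxy.trans h)
    | succ h1 h2 h3 h4 => exact succ (hxy.trans h1) h2 h3 h4
  | succ h1 h2 h3 _ ih =>
    rw [Nat.succ_add]
    exact succ h1 h2 h3 (ih h')

/-- If every crossing of `f'` contains two crossings of `f`, the number of crossings doubles. -/
theorem double {n : ℕ} {x y c : ℝ} (h : HasCrossings f' a' b' n x y) (hc : c ≤ x)
    (hf : ∀ s t, c ≤ s → s ≤ t → Crosses f' a' b' s t → HasCrossings f a b 2 s t) :
    HasCrossings f a b (n * 2) x y := by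
  induction h with
  | zero hxy => simpa using zero hxy
  | succ h1 h2 h3 _ ih =>
    have h4 := (zero (f := f) (a := a) (b := b) h1).append (hf _ _ (hc.trans h1) h2 h3)
    have h5 := h4.append (ih (hc.trans (h1.trans h2)))
    rwa [zero_add, add_comm, ← Nat.succ_mul] at h5

/-- A continuous function that tends to infinity crosses `[a, b]` only boundedly often. -/
theorem exists_le (hab : a < b) {c : ℝ} (hf : ContinuousOn f (Set.Ici c))
    (hlim : Filter.Tendsto f Filter.atTop Filter.atTop) :
    ∃ N : ℕ, ∀ n y, HasCrossings f a b n c y → n ≤ N := by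
  obtain ⟨Y₀, hY₀⟩ := Filter.eventually_atTop.1 (hlim.eventually_gt_atTop a)
  let Y := max Y₀ c
  have hY : ∀ t, Y ≤ t → a < f t := fun t ht => hY₀ t ((le_max_left _ _).trans ht)
  have hcY : c ≤ Y := le_max_right _ _
  have huc := isCompact_Icc.uniformContinuousOn_of_continuous
    (hf.mono (Set.Icc_subset_Ici_self : Set.Icc c (Y + 1) ⊆ Set.Ici c))
  obtain ⟨η, hη, hη'⟩ := Metric.uniformContinuousOn_iff.1 huc (b - a) (sub_pos.2 hab)
  -- A crossing begins before `Y` and has length at least `κ`.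
  let κ := min η 1
  have hκ : 0 < κ := lt_min hη one_pos
  have hcross : ∀ s t, c ≤ s → s ≤ t → Crosses f a b s t → s ≤ Y ∧ s + κ ≤ t := by
    intro s t hs hst h
    have hsY : s ≤ Y := by
      by_contra! hYs
      rcases h with h | h
      · exact (hY s hYs.le).not_ge h.1
      · exact (hY t (hYs.le.trans hst)).not_ge h.2
    refine ⟨hsY, ?_⟩
    by_contra! ht
    have h1 : κ ≤ η := min_le_left _ _
    have h2 : κ ≤ 1 := min_le_right _ _
    have h3 := hη' s ⟨hs, by linarith⟩ t ⟨hs.trans hst, by linarith⟩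
      (by rw [dist_comm, Real.dist_eq, abs_of_nonneg (sub_nonneg.2 hst)]; linarith)
    rw [Real.dist_eq, abs_lt] at h3
    rcases h with h | h <;> linarith [h.1, h.2, h3.1, h3.2]
  have hcount : ∀ n x y, HasCrossings f a b n x y → c ≤ x → 1 ≤ n → x + n * κ ≤ Y + κ := by
    intro n x y h
    induction h with
    | zero _ => simp
    | @succ n x s t y h1 h2 h3 h4 ih =>
      intro hx _
      obtain ⟨h5, h6⟩ := hcross s t (hx.trans h1) h2 h3
      rcases Nat.eq_zero_or_pos n with rfl | hn
      · simpa using h1.trans h5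
      · have h7 := ih (hx.trans (h1.trans h2)) hn
        push_cast
        linarith
  refine ⟨⌈(Y + κ - c) / κ⌉₊, fun n y h => ?_⟩
  rcases Nat.eq_zero_or_pos n with rfl | hn
  · exact Nat.zero_le _
  · have h1 := hcount n c y h le_rfl hn
    have h2 : (n : ℝ) ≤ (Y + κ - c) / κ := by
      rw [le_div_iff₀ hκ]
      linarith
    exact_mod_cast h2.trans (Nat.le_ceil _)

end HasCrossings

/-! ### Iterates of curves to infinity -/

section Iterates

variable {T : Set ℂ} {F : ℂ → ℂ}

theorem exists_subset_stripTranslate_closedTract (hT : IsOpen T)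
    (hF : IsConformalIso F T {z : ℂ | 0 < z.re}) (hb : BoundedToLeft T F)
    (hS : ∀ z ∈ T, |z.im| < π) {γ : ℝ → ℂ} (hγ : ContinuousOn γ (Set.Ici 0))
    (hγU : ∀ t, 0 ≤ t → γ t ∈ closure (periodicDomain T F)) :
    ∃ m, ∀ t, 0 ≤ t → γ t ∈ stripTranslate (closedTract T F) m := by
  have hsub := fun z (hz : z ∈ closure (periodicDomain T F)) =>
    closure_periodicDomain_subset hT hF hb hS hz
  obtain ⟨m, hm⟩ := hsub _ (hγU 0 le_rfl)
  refine ⟨m, fun t ht => ?_⟩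
  have hC : IsPreconnected (γ '' Set.Ici 0) := isPreconnected_Ici.image γ hγ
  refine hC.subset_stripTranslate (S := closedTract T F) (fun z hz => hS z hz.1) ?_
    ⟨0, Set.self_mem_Ici, rfl⟩ hm ⟨t, ht, rfl⟩
  rintro _ ⟨u, hu, rfl⟩
  exact hsub _ (hγU u hu)

/-- The iterates of a curve to infinity in the Julia set are curves to infinity, and each of them
stays in a single translate of the tract. -/
theorem iterate_curve (hT : IsOpen T) (hF : IsConformalIso F T {z : ℂ | 0 < z.re})
    (hlim : Filter.Tendsto F (Bornology.cobounded ℂ ⊓ Filter.principal T) (Bornology.cobounded ℂ))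
    (hb : BoundedToLeft T F) (hS : ∀ z ∈ T, |z.im| < π) {γ : ℝ → ℂ}
    (hγ : ContinuousOn γ (Set.Ici 0))
    (hγJ : ∀ t, 0 ≤ t → γ t ∈ logJuliaSet (periodicDomain T F) (periodicExtension F))
    (hγlim : Filter.Tendsto γ Filter.atTop (Bornology.cobounded ℂ)) :
    ∃ (Γ : ℕ → ℝ → ℂ) (m : ℕ → ℤ), (∀ n, ContinuousOn (Γ n) (Set.Ici 0)) ∧
      (∀ n, Filter.Tendsto (Γ n) Filter.atTop (Bornology.cobounded ℂ)) ∧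
      (∀ n t, 0 ≤ t → Γ n t - 2 * π * Complex.I * m n ∈ T) ∧
      ∀ n t, 0 ≤ t → Γ (n + 1) t = F (Γ n t - 2 * π * Complex.I * m n) := by
  let G := extendFrom (periodicDomain T F) (periodicExtension F)
  let Γ : ℕ → ℝ → ℂ := fun n t => G^[n] (γ t)
  have hΓU : ∀ n t, 0 ≤ t → Γ n t ∈ closure (periodicDomain T F) := fun n t ht => hγJ t ht n
  have hstep : ∀ n (m : ℤ), (∀ t, 0 ≤ t → Γ n t ∈ stripTranslate T m) → ∀ t, 0 ≤ t →
      Γ (n + 1) t = F (Γ n t - 2 * π * Complex.I * m) := by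
    intro n m hm t ht
    have h1 : Γ (n + 1) t = G (Γ n t) := Function.iterate_succ_apply' G n (γ t)
    rw [h1, ← periodicExtension_eq (F := F) hS (hm t ht)]
    exact extendFrom_periodicExtension hT hF hb hS (hΓU n t ht)
  have hcurve : ∀ n, ContinuousOn (Γ n) (Set.Ici 0) ∧
      Filter.Tendsto (Γ n) Filter.atTop (Bornology.cobounded ℂ) := by
    intro n
    induction n with
    | zero => exact ⟨hγ, hγlim⟩
    | succ n ih =>
      obtain ⟨m, hm⟩ := exists_subset_stripTranslate_closedTract hT hF hb hS ih.1 (hΓU n)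
      have hmT : ∀ t, 0 ≤ t → Γ n t ∈ stripTranslate T m := fun t ht => (hm t ht).1
      have heq := hstep n m hmT
      constructor
      · refine ContinuousOn.congr ?_ fun t ht => heq t ht
        exact hF.1.continuousOn.comp (ih.1.sub continuousOn_const) fun t ht => hmT t ht
      · have hshift : Filter.Tendsto (fun t => Γ n t - 2 * π * Complex.I * m) Filter.atTop
            (Bornology.cobounded ℂ) := by
          rw [Metric.cobounded_eq_cocompact] at ih ⊢
          exact (Homeomorph.subRight
            (2 * π * Complex.I * (m : ℂ))).isClosedEmbedding.tendsto_cocompact.comp ih.2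
        refine (hlim.comp (Filter.tendsto_inf.2 ⟨hshift, Filter.tendsto_principal.2 ?_⟩)).congr' ?_
        · filter_upwards [Filter.eventually_ge_atTop 0] with t ht using hmT t ht
        · filter_upwards [Filter.eventually_ge_atTop 0] with t ht using (heq t ht).symm
  choose m hm using fun n =>
    exists_subset_stripTranslate_closedTract hT hF hb hS (hcurve n).1 (hΓU n)
  exact ⟨Γ, m, fun n => (hcurve n).1, fun n => (hcurve n).2, fun n t ht => (hm n t ht).1,
    fun n => hstep n (m n) fun t ht => (hm n t ht).1⟩

end Iterates

namespace TractDatum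

variable {ξ : TractDatum} {F : ℂ → ℂ}

/-- A curve in the tract whose image crosses the annulus between the radii `a` and `b` of two
vertical geodesics that lie in the middle and in the lower channel of a wiggle traverses both
channels. -/
theorem exists_traverse_of_crosses (hF : ContinuousOn F ξ.tract) {j : ℕ} {x a b : ℝ} (hab : a < b)
    (ha : ∀ z ∈ ξ.verticalGeodesic F a, x < z.re ∧ z.re < ξ.R j ∧ -(π / 3) < z.im)
    (hb : ∀ z ∈ ξ.verticalGeodesic F b, x < z.re ∧ z.im < -(π / 3)) {δ : ℝ → ℂ} {s t : ℝ}
    (hst : s ≤ t) (hδ : ContinuousOn δ (Set.Icc s t)) (hδT : ∀ u ∈ Set.Icc s t, δ u ∈ ξ.tract)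
    (hcross : Crosses (fun u => ‖F (δ u)‖) a b s t) :
    ∃ u v w, s ≤ u ∧ u ≤ v ∧ v ≤ w ∧ w ≤ t ∧ x < (δ u).re ∧ (δ v).re < ξ.r j + 1 ∧
      x < (δ w).re := by
  have hcont : ContinuousOn (fun u => ‖F (δ u)‖) (Set.uIcc s t) := by
    rw [Set.uIcc_of_le hst]
    exact (hF.comp hδ hδT).norm
  have hIVT := intermediate_value_uIcc hcont
  have hmem : a ∈ Set.uIcc ‖F (δ s)‖ ‖F (δ t)‖ ∧ b ∈ Set.uIcc ‖F (δ s)‖ ‖F (δ t)‖ := by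
    simp only [Set.mem_uIcc]
    rcases hcross with ⟨h1, h2⟩ | ⟨h1, h2⟩
    · exact ⟨Or.inl ⟨h1, hab.le.trans h2⟩, Or.inl ⟨h1.trans hab.le, h2⟩⟩
    · exact ⟨Or.inr ⟨h2, hab.le.trans h1⟩, Or.inr ⟨h2.trans hab.le, h1⟩⟩
  obtain ⟨p, hp, hpa⟩ := hIVT hmem.1
  obtain ⟨q, hq, hqb⟩ := hIVT hmem.2
  rw [Set.uIcc_of_le hst] at hp hq
  have hsub : Set.uIcc p q ⊆ Set.Icc s t := Set.ordConnected_Icc.uIcc_subset hp hq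
  have hp' := ha (δ p) ⟨hδT p hp, hpa⟩
  have hq' := hb (δ q) ⟨hδT q hq, hqb⟩
  obtain ⟨_, ⟨v, hv, rfl⟩, hvr⟩ := exists_re_lt_of_isPreconnected
    (isPreconnected_uIcc.image δ (hδ.mono hsub))
    (by rintro _ ⟨u, hu, rfl⟩; exact hδT u (hsub hu)) ⟨p, Set.left_mem_uIcc, rfl⟩ hp'.2.1 hp'.2.2
    ⟨q, Set.right_mem_uIcc, rfl⟩ hq'.2
  rcases Set.mem_uIcc.1 hv with h | h
  · exact ⟨p, v, q, hp.1, h.1, h.2, hq.2, hp'.1, hvr, hq'.1⟩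
  · exact ⟨q, v, p, hq.1, h.1, h.2, hp.2, hq'.1, hvr, hp'.1⟩

end TractDatum

/-! ### Absence of curves to infinity -/

namespace TractDatum

/-- The iterates of a curve to infinity start to the left of successive wiggles, so the `n`-th one
crosses the annulus attached to its wiggle. By doubling, the initial curve then crosses a fixed
annulus at least `2 ^ n` times, for every `n`. -/
theorem not_containsCurveToInfinity {ξ : TractDatum} {F : ℂ → ℂ}
    (hF : IsNormalisedMap ξ.tract F) (hb : BoundedToLeft ξ.tract F) {ρ ρ' : ℕ → ℝ}
    (hρ : ∀ j, ξ.r (j + 1) + ξ.R j + 1 + 2 * π ≤ ρ (j + 1))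
    (hρρ' : ∀ j, ρ (j + 1) < ρ' (j + 1)) (hρ' : ∀ j, ρ' (j + 1) < ξ.τ (j + 1))
    (hτR : ∀ j, ξ.τ j < ξ.R j)
    (hΓ : ∀ j, ∀ z ∈ ξ.verticalGeodesic F (ρ (j + 1)),
      ξ.τ j < z.re ∧ z.re < ξ.R j ∧ -(π / 3) < z.im)
    (hΓ' : ∀ j, ∀ z ∈ ξ.verticalGeodesic F (ρ' (j + 1)), ξ.τ j < z.re ∧ z.im < -(π / 3))
    (hleft : ∀ j, ∀ z ∈ ξ.tract, z.re < ξ.τ j → ‖F z‖ < ρ' (j + 1)) :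
    ¬ ContainsCurveToInfinity
        (logJuliaSet (periodicDomain ξ.tract F) (periodicExtension F)) := by
  rintro ⟨γ, hγ, hγJ, hγlim⟩
  have hpi := Real.pi_pos
  have hS : ∀ z ∈ ξ.tract, |z.im| < π := fun z hz => hz.1.2
  have hr : ∀ j : ℕ, (j : ℝ) + 6 < ξ.r j := ξ.add_six_lt_r
  obtain ⟨Γ, m, hΓc, hΓlim, hΓT, hΓstep⟩ :=
    iterate_curve ξ.isOpen_tract hF.conformal hF.tendsto_infty hb hS hγ hγJ hγlim
  obtain ⟨j, hj⟩ := exists_nat_gt ‖Γ 0 0‖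
  -- The starting points of the iterates lie to the left of successive wiggles.
  have hstart : ∀ n, ‖Γ n 0‖ < ρ' (j + n + 1) := by
    intro n
    induction n with
    | zero =>
      have h1 := hr (j + 1)
      have h2 := hρ j
      have h3 := hρρ' j
      have h4 := ξ.r_R j
      have h5 := hr j
      have h6 : (0 : ℝ) ≤ j := j.cast_nonneg
      push_cast at h1
      simpa using (by linarith : ‖Γ 0 0‖ < ρ' (j + 1))
    | succ n ih =>
      rw [hΓstep n 0 le_rfl]
      refine hleft (j + n + 1) _ (hΓT n 0 le_rfl) ?_
      rw [re_sub_two_pi_I_mul]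
      exact (Complex.re_le_norm _).trans_lt (ih.trans (hρ' (j + n)))
  have hstartR : ∀ n, ‖Γ n 0‖ < ξ.R (j + n + 1) := fun n =>
    (hstart n).trans ((hρ' _).trans (hτR _))
  have him : ∀ n t, 0 ≤ t → |(Γ n t).im| < ξ.R (j + n + 1) + 2 * π := by
    intro n t ht
    have h1 := hS _ (hΓT n 0 le_rfl)
    have h2 := hS _ (hΓT n t ht)
    rw [im_sub_two_pi_I_mul] at h1 h2
    have h3 := (Complex.abs_im_le_norm (Γ n 0)).trans_lt (hstartR n)
    rw [abs_lt] at *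
    constructor <;> linarith [h1.1, h1.2, h2.1, h2.2, h3.1, h3.2]
  have hre : ∀ n t, 0 ≤ t → 0 ≤ (Γ n t).re := by
    intro n t ht
    have h1 := (hΓT n t ht).1.1
    rw [re_sub_two_pi_I_mul] at h1
    linarith
  let a : ℕ → ℝ := fun n => ρ (j + n + 1 + 1)
  let b : ℕ → ℝ := fun n => ρ' (j + n + 1 + 1)
  -- Each crossing of the annulus by an iterate comes from a traversal of two channels by the
  -- preceding iterate, which thereby crosses its own annulus twice.
  have hdouble : ∀ n s t, 0 ≤ s → s ≤ t →
      Crosses (fun u => ‖Γ (n + 1) u‖) (a (n + 1)) (b (n + 1)) s t →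
      HasCrossings (fun u => ‖Γ n u‖) (a n) (b n) 2 s t := by
    intro n s t hs hst hcross
    have hIcc : ∀ u ∈ Set.Icc s t, 0 ≤ u := fun u hu => hs.trans hu.1
    have hcross' : Crosses (fun u => ‖F (Γ n u - 2 * π * Complex.I * m n)‖)
        (ρ (j + n + 2 + 1)) (ρ' (j + n + 2 + 1)) s t := by
      simp only [Crosses] at hcross ⊢
      rw [← hΓstep n s hs, ← hΓstep n t (hs.trans hst)]
      exact hcross
    obtain ⟨u, v, w, hsu, huv, hvw, hwt, hu, hv, hw⟩ := exists_traverse_of_crosses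
      (δ := fun u => Γ n u - 2 * π * Complex.I * m n) hF.conformal.1.continuousOn (hρρ' (j + n + 2))
      (hΓ _) (hΓ' _) hst (((hΓc n).mono hIcc).sub continuousOn_const)
      (fun u hu => hΓT n u (hIcc u hu)) hcross'
    rw [re_sub_two_pi_I_mul] at hu hv hw
    have hfar : ∀ u, ξ.τ (j + n + 2) < (Γ n u).re → b n ≤ ‖Γ n u‖ := fun u hu =>
      ((hρ' (j + n + 1)).trans (hu.trans_le (Complex.re_le_norm _))).le
    have hnear : ‖Γ n v‖ ≤ a n := by
      have hv0 : 0 ≤ v := hs.trans (hsu.trans huv)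
      have h1 := Complex.norm_le_abs_re_add_abs_im (Γ n v)
      rw [abs_of_nonneg (hre n v hv0)] at h1
      have h2 := him n v hv0
      have h3 : ξ.r (j + n + 2) + ξ.R (j + n + 1) + 1 + 2 * π ≤ a n := hρ (j + n + 1)
      linarith
    exact .succ hsu huv (Or.inr ⟨hfar u hu, hnear⟩)
      (.succ le_rfl hvw (Or.inl ⟨hnear, hfar w hw⟩) (.zero hwt))
  have hpow : ∀ k n, ∃ y, HasCrossings (fun u => ‖Γ n u‖) (a n) (b n) (2 ^ k) 0 y := by
    intro k
    induction k with
    | zero =>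
      intro n
      obtain ⟨y, hy, hy0⟩ := (((tendsto_norm_atTop_iff_cobounded.2 (hΓlim n)).eventually_ge_atTop
        (b n)).and (Filter.eventually_ge_atTop 0)).exists
      refine ⟨y, .succ le_rfl hy0 (Or.inl ⟨?_, hy⟩) (.zero le_rfl)⟩
      have h1 := hstartR n
      have h2 : ξ.r (j + n + 2) + ξ.R (j + n + 1) + 1 + 2 * π ≤ a n := hρ (j + n + 1)
      have h3 := hr (j + n + 2)
      have h4 : (0 : ℝ) ≤ (j + n + 2 : ℕ) := Nat.cast_nonneg _
      change ‖Γ n 0‖ ≤ a n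
      linarith
    | succ k ih =>
      intro n
      obtain ⟨y, hy⟩ := ih (n + 1)
      exact ⟨y, pow_succ 2 k ▸ hy.double le_rfl (hdouble n)⟩
  obtain ⟨N, hN⟩ := HasCrossings.exists_le (hρρ' (j + 0 + 1)) (hΓc 0).norm
    (tendsto_norm_atTop_iff_cobounded.2 (hΓlim 0))
  obtain ⟨y, hy⟩ := hpow N 0
  exact (hN _ y hy).not_gt Nat.lt_two_pow_self

end TractDatum

theorem mainTheorem2 (ν₀ : ℝ) (hν₀ : 0 < ν₀) (ξ : TractDatum) (F : ℂ → ℂ)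
    (hF : IsNormalisedMap ξ.tract F) (hξ : ξ.IsCounterexample ν₀ F) :
    IsBlogPeriodic (periodicDomain ξ.tract F) halfPlaneOne (periodicExtension F) ∧
    IsDisjointType (periodicDomain ξ.tract F) halfPlaneOne ∧
    ¬ ContainsCurveToInfinity
        (logJuliaSet (periodicDomain ξ.tract F) (periodicExtension F)) := by
  obtain ⟨hΞ, ρ, ρ', -, hradii, hgeod⟩ := hξ
  have hpi := Real.pi_pos
  have hS : ∀ z ∈ ξ.tract, |z.im| < π := fun z hz => hz.1.2
  have hre : ∀ z ∈ ξ.tract, 1 < z.re := fun z hz => by linarith [hz.1.1]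
  have hτR : ∀ j, ξ.τ j < ξ.R j := fun j => by linarith [ξ.τ_R j]
  have hrτ : ∀ j, ξ.r j + 1 ≤ ξ.τ j := fun j => by
    linarith [hΞ.r_R j, hΞ.τ_eq j, le_max_left (5 + 3 * ν₀) 30]
  have hρ : ∀ j, ξ.r (j + 1) + ξ.R j + 1 + 2 * π ≤ ρ (j + 1) := fun j =>
    (hradii (j + 1) (Nat.le_add_left 1 j)).1
  have hρρ' : ∀ j, ρ (j + 1) < ρ' (j + 1) := fun j =>
    let h := hradii (j + 1) (Nat.le_add_left 1 j)
    h.2.1.trans h.2.2.1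
  have hρ'τ : ∀ j, ρ' (j + 1) < ξ.τ (j + 1) := fun j => by
    linarith [(hradii (j + 1) (Nat.le_add_left 1 j)).2.2.2, hΞ.τ_eq (j + 1)]
  have hΓ : ∀ j, ∀ z ∈ ξ.verticalGeodesic F (ρ (j + 1)),
      ξ.τ j < z.re ∧ z.re < ξ.R j ∧ -(π / 3) < z.im := fun j z hz => by
    have h1 := (hgeod j).2.2 z (Or.inl hz)
    exact ⟨hΞ.τ_eq j ▸ h1.1, by linarith [h1.2], ((hgeod j).1 hz).2.1⟩
  have hΓ' : ∀ j, ∀ z ∈ ξ.verticalGeodesic F (ρ' (j + 1)), ξ.τ j < z.re ∧ z.im < -(π / 3) :=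
    fun j z hz => ⟨hΞ.τ_eq j ▸ ((hgeod j).2.2 z (Or.inr hz)).1, ((hgeod j).2.1 hz).2.2⟩
  have hρ'5 : ∀ j, 5 < ρ' (j + 1) := fun j => by
    have h1 := ξ.add_six_lt_r j
    have h2 := ξ.add_six_lt_r (j + 1)
    have h3 : (0 : ℝ) ≤ j := j.cast_nonneg
    have h4 : (0 : ℝ) ≤ (j + 1 : ℕ) := Nat.cast_nonneg _
    linarith [hρ j, hρρ' j, ξ.r_R j]
  have hafter : ∀ j, ξ.verticalGeodesic F (ρ' (j + 1)) ⊆ ξ.afterCrosscut j (ξ.τ j) :=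
    fun j z hz => Or.inl (hΓ' j z hz)
  have hb : BoundedToLeft ξ.tract F := TractDatum.boundedToLeft hF hrτ hτR hρ'5 hafter
  refine ⟨isBlogPeriodic_periodicExtension ξ.isOpen_tract hF.conformal hb hS ⟨4, ?_⟩,
    isDisjointType_periodicDomain ξ.isOpen_tract hF.conformal hb hS hre,
    TractDatum.not_containsCurveToInfinity hF hb hρ hρρ' hρ'τ hτR hΓ hΓ' fun j z hz hzτ =>
      TractDatum.norm_lt_of_mem_beforeCrosscut hF (hrτ j) (hτR j) (hρ'5 j) (hafter j) hz
        (Or.inr hzτ)⟩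
  rintro _ ⟨z, hz, rfl⟩
  exact hz.1.1.le
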